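/- For integers $0\le k\le n$ let $\binom{[n]}{k}=\{x\in\{0,1\}^n:\sum_i x_i=k\}$. A function $f\colon\binom{[n]}{k}\to\mathbb{R}$ is *$A$-valued* if $f(x)\in A$ for all $x$; it has *degree $d$* if there is a real polynomial $P$ in $n$ variables, of total degree at most $d$, with $f(x)=P(x_1,\dots,x_n)$ for all $x\in\binom{[n]}{k}$; it is an *$m$-junta* if there are a set $J\subseteq[n]$ with $|J|\le m$ and a function $g\colon\{0,1\}^J\to\mathbb{R}$ such that $f(x)=g(x|_J)$ for all $x\in\binom{[n]}{k}$. Let $A\subset\mathbb{R}$ be a finite set with $|A|\ge 2$, and let $d\ge 1$. For $s\ge 1$ let $W(A,s)$ be the minimal natural number $W$ such that every univariate real polynomial $P$ of degree at most $s$ with $P(0),P(1),\dots,P(W)\in A$ is constant. Put $$k(A,d)=d+\max_{1\le s\le d}\left\lfloor\frac{d}{s}\right\rfloor\bigl(W(A,s)-s\bigr).$$ 1. If $A$ is an arithmetic progression, then $k(A,d)=|A|\,d$. 2. There is a constant $m(A,d)$, depending only on $A$ and $d$, such that for every $k\ge k(A,d)$ and every $n\ge 2k$, every $A$-valued degree $d$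 function on $\binom{[n]}{k}$ is an $m(A,d)$-junta. 3. Conversely, if $1\le k<k(A,d)$, then for every $m$ there exist $n\ge 2k$ and an $A$-valued degree $d$ function on $\binom{[n]}{k}$ which is not an $m$-junta. -/

import Mathlib

namespace SliceJunta

/-- The slice `([n] choose k)`: all vectors in `{0,1}^n` of Hamming weight `k`. -/
def Slice (n k : ℕ) : Type :=
  {x : Fin n → Fin 2 // ∑ i, (x i : ℕ) = k}

/-- `f` takes all its values in `A`. -/
def IsValuedIn {n k : ℕ} (A : Finset ℝ) (f : Slice n k → ℝ) : Prop :=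
  ∀ x, f x ∈ A

/-- `f` has degree (at most) `d`: it is given on the slice by a real polynomial of total degree
at most `d` in the coordinates. -/
def HasDegree {n k : ℕ} (d : ℕ) (f : Slice n k → ℝ) : Prop :=
  ∃ P : MvPolynomial (Fin n) ℝ, P.totalDegree ≤ d ∧
    ∀ x, f x = MvPolynomial.eval (fun i => ((x.1 i : ℕ) : ℝ)) P

/-- `f` is a `J`-junta: on the slice, `f x` is a function of the restriction of `x` to `J`. -/
def IsJuntaOn {n k : ℕ} (J : Finset (Fin n)) (f : Slice n k → ℝ) : Prop :=
  ∃ g : (J → Fin 2) → ℝ, ∀ x, f x = g (fun j => x.1 j)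

/-- `f` is an `m`-junta: it is a `J`-junta for some set `J` of at most `m` coordinates. -/
def IsJunta {n k : ℕ} (m : ℕ) (f : Slice n k → ℝ) : Prop :=
  ∃ J : Finset (Fin n), J.card ≤ m ∧ IsJuntaOn J f

/-- Every real polynomial `P` of degree at most `d` with `P(0), ..., P(w) ∈ A` is constant. -/
def ForcesConstant (A : Finset ℝ) (d w : ℕ) : Prop :=
  ∀ P : Polynomial ℝ, P.natDegree ≤ d → (∀ i : ℕ, i ≤ w → P.eval (i : ℝ) ∈ A) →
    ∃ c : ℝ, P = Polynomial.C c

/-- `W(A,d)`: the minimal `w` such that every real polynomial `P` of degree at most `d`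
with `P(0), ..., P(w) ∈ A` is constant. -/
noncomputable def W (A : Finset ℝ) (d : ℕ) : ℕ :=
  sInf {w | ForcesConstant A d w}

/-- Some `w` forces constancy, so the infimum defining `W(A,d)` is a true minimum. -/
theorem forcesConstant_W (A : Finset ℝ) (d : ℕ) : ForcesConstant A d (W A d) := by
  refine Nat.sInf_mem (s := {w | ForcesConstant A d w}) ⟨A.card * d, ?_⟩
  intro P hP h
  obtain ⟨a, -, ha⟩ := Finset.exists_lt_card_fiber_of_mul_lt_card_of_maps_to
    (s := Finset.range (A.card * d + 1)) (t := A) (f := fun i : ℕ => P.eval (i : ℝ)) (n := d)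
    (fun i hi => h i (by have := Finset.mem_range.1 hi; omega)) (by simp)
  refine ⟨a, ?_⟩
  refine Polynomial.eq_of_natDegree_lt_card_of_eval_eq' P (Polynomial.C a)
    (((Finset.range (A.card * d + 1)).filter
      (fun i : ℕ => P.eval (i : ℝ) = a)).map Nat.castEmbedding) ?_ ?_
  · intro x hx
    simp only [Finset.mem_map, Finset.mem_filter] at hx
    obtain ⟨i, hi, rfl⟩ := hx
    simpa using hi.2
  · simpa using lt_of_le_of_lt hP ha

/-- `W(A,s) > s`, so the natural-number subtraction in `threshold` never truncates. -/
theorem lt_W {A : Finset ℝ} (hA : 2 ≤ A.card) {s : ℕ} (hs : 1 ≤ s) : s < W A s := by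
  by_contra hlt
  obtain ⟨a, ha, b, hb, hab⟩ := Finset.one_lt_card.1 hA
  have hinj : Set.InjOn (fun i : ℕ => (i : ℝ)) (Finset.range (s + 1)) :=
    fun x _ y _ hxy => Nat.cast_injective hxy
  set r : ℕ → ℝ := fun i => if i = 0 then a else b with hr
  set P := Lagrange.interpolate (Finset.range (s + 1)) (fun i : ℕ => (i : ℝ)) r with hPdef
  have hev : ∀ i, i ≤ s → P.eval (i : ℝ) = r i := fun i hi =>
    Lagrange.eval_interpolate_at_node r hinj (Finset.mem_range.2 (by omega))
  have hdeg : P.natDegree ≤ s := by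
    have h1 := Lagrange.degree_interpolate_lt r hinj
    rw [Finset.card_range] at h1
    exact Polynomial.natDegree_le_of_degree_le (Order.le_of_lt_succ (by exact_mod_cast h1))
  obtain ⟨c, hc⟩ := forcesConstant_W A s P hdeg (fun i hi => by
    rw [hev i (by omega), hr]
    dsimp only
    split_ifs <;> assumption)
  have h0 := hev 0 (by omega)
  have h1 := hev 1 hs
  rw [hc, Polynomial.eval_C] at h0 h1
  simp only [hr, if_true, one_ne_zero, if_false] at h0 h1
  exact hab (h0.symm.trans h1)

/-- `k(A,d) = d + max_{1 ≤ s ≤ d} ⌊d/s⌋ (W(A,s) - s)`. -/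
noncomputable def threshold (A : Finset ℝ) (d : ℕ) : ℕ :=
  d + (Finset.Icc 1 d).sup (fun s => d / s * (W A s - s))

/-- `A` is the arithmetic progression `{a, a + b, ..., a + (|A| - 1) b}` for some `a` and `b`. -/
def IsArithmeticProgression (A : Finset ℝ) : Prop :=
  ∃ a b : ℝ, ∀ y, y ∈ A ↔ ∃ i : ℕ, i < A.card ∧ y = a + i * b

end SliceJunta

namespace SliceJunta

open Finset

/-! Why the threshold appears: let `P` have degree `s`, fix a set `Q` of `r` points and many
disjoint blocks of size `e`, and let a function equal `P` of the number of full blocks when `Q` is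
full, and `P(0)` otherwise. Its degree is at most `r + s * e`, and it depends on unboundedly many
coordinates. At weight `k < r + (t + 1) * e` at most `t` blocks are full beside `Q`, so only `P(0),
..., P(t)` need lie in `A`. Optimising with `r + s * e ≤ d` and `t < W A s` gives `threshold A d`;
this is the converse direction, `exists_not_isJunta`.

For the junta theorem, such block structures are shown to be the only obstruction. If `f` is not a
junta, many disjoint pairs of coordinates can be found whose exchange changes `f`, each exchange
being witnessed on a bounded set (`HasPairDegree.exists_certificate`). Let `U` be the union of these
sets. By Ramsey's theorem there are many points outside `U` that are interchangeable for `f`; they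
absorb the weight not placed on `U`. What remains is a function on subsets of `U` of size at most `K
= threshold A d`, with values in `A`, given by a multilinear polynomial of degree at most `d` in
which every chosen pair has a point that occurs (`exists_expansion_of_not_junta`).

Such a polynomial has boundedly many variables (`exists_card_vars_bound`). Otherwise it has many
nonzero monomials `R ∪ B` with disjoint `B` of equal size `e`; take `e` minimal and apply Ramsey's
theorem to the blocks. The value on `R₀ ∪ (j blocks)` then becomes a nonconstant polynomial in `j`
of degree `s`, with `#R₀ + s * e ≤ d`. Weight `K` leaves room for `W A s` blocks, which forces this
polynomial to be constant (`lt_threshold_of_homogeneous`). -/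

/-! ### Bounds on `W` and the threshold of an arithmetic progression -/

theorem W_le (A : Finset ℝ) (s : ℕ) : W A s ≤ A.card * s := by
  refine Nat.sInf_le ?_
  intro P hP h
  obtain ⟨a, -, ha⟩ := Finset.exists_lt_card_fiber_of_mul_lt_card_of_maps_to
    (s := Finset.range (A.card * s + 1)) (t := A) (f := fun i : ℕ => P.eval (i : ℝ)) (n := s)
    (fun i hi => h i (by have := Finset.mem_range.1 hi; omega)) (by simp)
  refine ⟨a, ?_⟩
  refine Polynomial.eq_of_natDegree_lt_card_of_eval_eq' P (Polynomial.C a)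
    (((Finset.range (A.card * s + 1)).filter
      (fun i : ℕ => P.eval (i : ℝ) = a)).map Nat.castEmbedding) ?_ ?_
  · intro x hx
    simp only [Finset.mem_map, Finset.mem_filter] at hx
    obtain ⟨i, hi, rfl⟩ := hx
    simpa using hi.2
  · simpa using lt_of_le_of_lt hP ha

theorem threshold_le (A : Finset ℝ) (hA : 2 ≤ A.card) (d : ℕ) : threshold A d ≤ A.card * d := by
  have key : (Finset.Icc 1 d).sup (fun s => d / s * (W A s - s)) ≤ (A.card - 1) * d := by
    refine Finset.sup_le fun s _ => ?_
    calc d / s * (W A s - s) ≤ d / s * ((A.card - 1) * s) := by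
          refine Nat.mul_le_mul_left _ ?_
          have := W_le A s
          rw [Nat.sub_mul]
          omega
      _ = (A.card - 1) * (d / s * s) := by ring
      _ ≤ (A.card - 1) * d := Nat.mul_le_mul_left _ (Nat.div_mul_le_self d s)
  unfold threshold
  have : A.card * d = d + (A.card - 1) * d := by
    obtain ⟨c, hc⟩ : ∃ c, A.card = c + 1 := ⟨A.card - 1, by omega⟩
    rw [hc]; simp; ring
  omega

theorem le_threshold (A : Finset ℝ) {d s : ℕ} (hs : 1 ≤ s) (hsd : s ≤ d) :
    d + d / s * (W A s - s) ≤ threshold A d :=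
  Nat.add_le_add_left (Finset.le_sup (f := fun s => d / s * (W A s - s))
    (Finset.mem_Icc.2 ⟨hs, hsd⟩)) d

/-- The linear polynomial `a + b X` runs through the progression at `0, ..., |A| - 1` and is not
constant. -/
theorem card_le_W_one {A : Finset ℝ} (hA : 2 ≤ A.card) (h : IsArithmeticProgression A) :
    A.card ≤ W A 1 := by
  obtain ⟨a, b, hab⟩ := h
  by_contra hlt
  push Not at hlt
  obtain ⟨c, hc⟩ := forcesConstant_W A 1 (Polynomial.C a + Polynomial.C b * Polynomial.X)
    (by compute_degree) (fun i hi => (hab _).2 ⟨i, by omega, by simp; ring⟩)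
  have hb : b = 0 := by
    have h0 := congrArg (Polynomial.eval 0) hc
    have h1 := congrArg (Polynomial.eval 1) hc
    simp at h0 h1
    linarith
  obtain ⟨x, hx, y, hy, hxy⟩ := Finset.one_lt_card.1 hA
  obtain ⟨i, -, hi⟩ := (hab x).1 hx
  obtain ⟨j, -, hj⟩ := (hab y).1 hy
  exact hxy (by simp [hi, hj, hb])

theorem threshold_of_isArithmeticProgression {A : Finset ℝ} (hA : 2 ≤ A.card) {d : ℕ} (hd : 1 ≤ d)
    (h : IsArithmeticProgression A) : threshold A d = A.card * d := by
  refine le_antisymm (threshold_le A hA d) ?_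
  refine le_trans ?_ (le_threshold A le_rfl hd)
  have := card_le_W_one hA h
  rw [Nat.div_one]
  calc A.card * d = d + d * (A.card - 1) := by
        obtain ⟨c, hc⟩ : ∃ c, A.card = c + 1 := ⟨A.card - 1, by omega⟩
        rw [hc]; simp; ring
    _ ≤ d + d * (W A 1 - 1) := by gcongr

/-! ### Ramsey's theorem for hypergraphs -/

/-- Off-diagonal hypergraph Ramsey theorem for `j`-element subsets and `C` colours. -/
theorem exists_monochromatic (C j : ℕ) : ∀ ν : Fin C → ℕ, ∃ M, ∀ {ι : Type} [DecidableEq ι]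
    (V : Finset ι), M ≤ #V → ∀ χ : Finset ι → Fin C,
      ∃ a, ∃ H ⊆ V, ν a ≤ #H ∧ ∀ Y ⊆ H, #Y = j → χ Y = a := by
  induction j with
  | zero =>
    intro ν
    refine ⟨∑ a, ν a, fun V hV χ => ⟨χ ∅, V, subset_rfl, ?_, ?_⟩⟩
    · exact (Finset.single_le_sum (f := ν) (fun _ _ => Nat.zero_le _) (Finset.mem_univ _)).trans hV
    · intro Y _ hY
      rw [Finset.card_eq_zero.1 hY]
  | succ j ihj =>
    intro ν
    -- Erdős–Szekeres induction on the sum of the target sizes. The case `j`, applied to the link of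
    -- a point `x`, gives `V₁` on which all `j + 1`-sets through `x` would get one colour `a`.
    -- Inside `V₁` the target for `a` may be lowered by one, since `x` can be added back.
    induction hσ : ∑ a, ν a using Nat.strong_induction_on generalizing ν with
    | _ σ ih =>
    by_cases h0 : ∃ a, ν a = 0
    · obtain ⟨a, ha⟩ := h0
      refine ⟨0, fun V _ χ => ⟨a, ∅, by simp, by simp [ha], fun Y hY hc => ?_⟩⟩
      rw [Finset.subset_empty.1 hY] at hc
      simp at hc
    · push Not at h0
      have hdec : ∀ a, ∃ M, ∀ {ι : Type} [DecidableEq ι]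
          (V : Finset ι), M ≤ #V → ∀ χ : Finset ι → Fin C,
          ∃ b, ∃ H ⊆ V, Function.update ν a (ν a - 1) b ≤ #H ∧
            ∀ Y ⊆ H, #Y = j + 1 → χ Y = b := by
        intro a
        refine ih _ ?_ _ rfl
        rw [← hσ]
        refine Finset.sum_lt_sum (fun b _ => ?_) ⟨a, Finset.mem_univ _, ?_⟩
        · by_cases hb : b = a
          · subst hb; simp
          · simp [hb]
        · have := h0 a
          simp; omega
      choose Mf hMf using hdec
      obtain ⟨M₀, hM₀⟩ := ihj (fun _ => ∑ a, Mf a)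
      refine ⟨M₀ + 1, fun V hV χ => ?_⟩
      obtain ⟨x, hx⟩ : V.Nonempty := Finset.card_pos.1 (by omega)
      obtain ⟨a, V₁, hV₁, hcard, hcol⟩ := hM₀ (V.erase x)
        (by rw [Finset.card_erase_of_mem hx]; omega) (fun Y => χ (insert x Y))
      have hxV₁ : x ∉ V₁ := fun h => by simpa using hV₁ h
      have hVV : V₁ ⊆ V := hV₁.trans (Finset.erase_subset _ _)
      obtain ⟨b, H, hH, hHc, hHcol⟩ := hMf a V₁
        ((Finset.single_le_sum (f := Mf) (fun _ _ => Nat.zero_le _)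
          (Finset.mem_univ a)).trans hcard) χ
      by_cases hb : b = a
      · subst hb
        refine ⟨b, insert x H, Finset.insert_subset hx (hH.trans hVV), ?_, ?_⟩
        · rw [Finset.card_insert_of_notMem (fun h => hxV₁ (hH h))]
          simp at hHc
          omega
        · intro Y hY hYc
          by_cases hxY : x ∈ Y
          · have := hcol (Y.erase x) (fun y hy => by
              have h1 := hY (Finset.mem_of_mem_erase hy)
              have h2 := Finset.ne_of_mem_erase hy
              exact hH ((Finset.mem_insert.1 h1).resolve_left h2))
              (by rw [Finset.card_erase_of_mem hxY]; omega)
            simpa [Finset.insert_erase hxY] using this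
          · refine hHcol Y (fun y hy => ?_) hYc
            exact (Finset.mem_insert.1 (hY hy)).resolve_left (fun h => hxY (h ▸ hy))
      · refine ⟨b, H, hH.trans hVV, ?_, hHcol⟩
        simpa [hb] using hHc

/-- One size is made monochromatic at a time; passing to a subset preserves what was already
achieved. -/
theorem exists_homogeneous_fin (C m N : ℕ) : ∃ M, ∀ {ι : Type} [DecidableEq ι]
    (V : Finset ι), M ≤ #V → ∀ χ : Finset ι → Fin C,
      ∃ H ⊆ V, N ≤ #H ∧ ∀ Y ⊆ H, ∀ Y' ⊆ H, #Y = #Y' → #Y < m → χ Y = χ Y' := by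
  induction m with
  | zero => exact ⟨N, fun V hV χ => ⟨V, subset_rfl, hV, fun _ _ _ _ _ h => by omega⟩⟩
  | succ m ih =>
    obtain ⟨M, hM⟩ := ih
    obtain ⟨M', hM'⟩ := exists_monochromatic C m (fun _ => M)
    refine ⟨M', fun V hV χ => ?_⟩
    obtain ⟨a, V₁, hV₁, hc, hcol⟩ := hM' V hV χ
    obtain ⟨H, hH, hHc, hHcol⟩ := hM V₁ hc χ
    refine ⟨H, hH.trans hV₁, hHc, fun Y hY Y' hY' he hlt => ?_⟩
    rcases Nat.lt_succ_iff_lt_or_eq.1 hlt with h | h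
    · exact hHcol Y hY Y' hY' he h
    · rw [hcol Y (hY.trans hH) h, hcol Y' (hY'.trans hH) (he ▸ h)]

/-- Hypergraph Ramsey theorem, simultaneously for all sizes less than `m`. -/
theorem exists_homogeneous (C m N : ℕ) : ∃ M, ∀ {ι κ : Type} [DecidableEq ι] [Fintype κ]
    (V : Finset ι), M ≤ #V → Fintype.card κ ≤ C → ∀ χ : Finset ι → κ,
      ∃ H ⊆ V, N ≤ #H ∧ ∀ Y ⊆ H, ∀ Y' ⊆ H, #Y = #Y' → #Y < m → χ Y = χ Y' := by
  obtain ⟨M, hM⟩ := exists_homogeneous_fin C m N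
  refine ⟨M, fun {ι κ} _ _ V hV hκ χ => ?_⟩
  obtain ⟨φ⟩ : Nonempty (κ ↪ Fin C) :=
    Function.Embedding.nonempty_of_card_le (by simpa using hκ)
  obtain ⟨H, hH, hHc, hcol⟩ := hM V hV (fun Y => φ (χ Y))
  exact ⟨H, hH, hHc, fun Y hY Y' hY' he hlt => φ.injective (hcol Y hY Y' hY' he hlt)⟩

/-! ### Unions of disjoint blocks -/

section Blocks

variable {α ι : Type} [DecidableEq α]

theorem card_union_biUnion_blocks {R : Finset α} {B : ι → Finset α} {H : Finset ι} {e : ℕ}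
    (hBe : ∀ l ∈ H, #(B l) = e) (hdisj : (H : Set ι).PairwiseDisjoint B)
    (hR : ∀ l ∈ H, Disjoint R (B l)) {R' : Finset α} (hR' : R' ⊆ R) {Y : Finset ι} (hY : Y ⊆ H) :
    #(R' ∪ Y.biUnion B) = #R' + #Y * e := by
  rw [Finset.card_union_of_disjoint, Finset.card_biUnion, Finset.sum_const_nat]
  · exact fun l hl => hBe l (hY hl)
  · exact fun l hl m hm hlm => hdisj (hY hl) (hY hm) hlm
  · rw [Finset.disjoint_biUnion_right]
    exact fun l hl => (hR l (hY hl)).mono_left hR'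

theorem block_subset_union_biUnion_iff [DecidableEq ι] {R : Finset α} {B : ι → Finset α} {H : Finset ι} {e : ℕ}
    (he : 1 ≤ e) (hBe : ∀ l ∈ H, #(B l) = e) (hdisj : (H : Set ι).PairwiseDisjoint B)
    (hR : ∀ l ∈ H, Disjoint R (B l)) {R' : Finset α} (hR' : R' ⊆ R) {Y : Finset ι} (hY : Y ⊆ H)
    {l : ι} (hl : l ∈ H) : B l ⊆ R' ∪ Y.biUnion B ↔ l ∈ Y := by
  refine ⟨fun h => ?_, fun h => (Finset.subset_biUnion_of_mem B h).trans subset_union_right⟩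
  obtain ⟨x, hx⟩ : (B l).Nonempty := Finset.card_pos.1 (by rw [hBe l hl]; omega)
  rcases Finset.mem_union.1 (h hx) with h1 | h1
  · exact absurd hx (Finset.disjoint_left.1 (hR l hl) (hR' h1))
  · obtain ⟨m, hm, hxm⟩ := Finset.mem_biUnion.1 h1
    by_contra hlY
    exact Finset.disjoint_left.1 (hdisj hl (hY hm) (fun h => hlY (h ▸ hm))) hx hxm

theorem union_biUnion_inter {R : Finset α} {B : ι → Finset α} {H : Finset ι}
    (hR : ∀ l ∈ H, Disjoint R (B l)) {R' : Finset α} (hR' : R' ⊆ R) {Y : Finset ι} (hY : Y ⊆ H) :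
    (R' ∪ Y.biUnion B) ∩ R = R' := by
  ext x
  simp only [Finset.mem_inter, Finset.mem_union, Finset.mem_biUnion]
  constructor
  · rintro ⟨h | ⟨l, hl, hx⟩, hxR⟩
    · exact h
    · exact absurd hx (Finset.disjoint_left.1 (hR l (hY hl)) hxR)
  · exact fun h => ⟨Or.inl h, hR' h⟩

/-- By `hfull`, a set with nonzero coefficient never cuts a block, so it decomposes uniquely into a
part of `R` and a union of whole blocks. -/
theorem sum_powerset_union_biUnion [DecidableEq ι] {c : Finset α → ℝ} {R : Finset α} {B : ι → Finset α}
    {H : Finset ι} {e : ℕ} (he : 1 ≤ e) (hBe : ∀ l ∈ H, #(B l) = e)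
    (hdisj : (H : Set ι).PairwiseDisjoint B) (hR : ∀ l ∈ H, Disjoint R (B l))
    (hfull : ∀ S ⊆ R ∪ H.biUnion B, c S ≠ 0 → ∀ l ∈ H, B l ⊆ S ∨ Disjoint (B l) S)
    {R' : Finset α} (hR' : R' ⊆ R) {Y : Finset ι} (hY : Y ⊆ H) :
    ∑ S ∈ (R' ∪ Y.biUnion B).powerset, c S =
      ∑ Z ∈ Y.powerset, ∑ T ∈ R'.powerset, c (T ∪ Z.biUnion B) := by
  rw [← Finset.sum_product']
  symm
  refine Finset.sum_of_injOn (fun p => p.2 ∪ p.1.biUnion B) ?_ ?_ ?_ (fun _ _ => rfl)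
  · rintro ⟨Z, T⟩ h ⟨Z', T'⟩ h' heq
    simp only [Finset.coe_product, Set.mem_prod, Finset.mem_coe, Finset.mem_powerset] at h h'
    dsimp only at heq
    have hT : T = T' := by
      rw [← union_biUnion_inter hR (h.2.trans hR') (h.1.trans hY), heq,
        union_biUnion_inter hR (h'.2.trans hR') (h'.1.trans hY)]
    have hZ : Z = Z' := by
      have hmem : ∀ l ∈ H, (l ∈ Z ↔ l ∈ Z') := fun l hl => by
        rw [← block_subset_union_biUnion_iff he hBe hdisj hR (h.2.trans hR') (h.1.trans hY) hl, heq,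
          block_subset_union_biUnion_iff he hBe hdisj hR (h'.2.trans hR') (h'.1.trans hY) hl]
      ext l
      exact ⟨fun hl => (hmem l (hY (h.1 hl))).1 hl, fun hl => (hmem l (hY (h'.1 hl))).2 hl⟩
    rw [hT, hZ]
  · rintro ⟨Z, T⟩ h
    simp only [Finset.coe_product, Set.mem_prod, Finset.mem_coe, Finset.mem_powerset] at h ⊢
    exact Finset.union_subset_union h.2 (Finset.biUnion_subset_biUnion_of_subset_left _ h.1)
  · intro S hS hSn
    by_contra hc
    refine hSn ⟨(Y.filter (fun l => B l ⊆ S), S ∩ R'), ?_, ?_⟩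
    · simpa [Set.subset_def] using fun l hl _ => hl
    · rw [Finset.mem_powerset] at hS
      have hS' : S ⊆ R ∪ H.biUnion B :=
        hS.trans (Finset.union_subset_union hR' (Finset.biUnion_subset_biUnion_of_subset_left _ hY))
      ext x
      simp only [Finset.mem_union, Finset.mem_inter, Finset.mem_biUnion, Finset.mem_filter]
      constructor
      · rintro (h | ⟨l, ⟨_, h1⟩, h2⟩)
        · exact h.1
        · exact h1 h2
      · intro hx
        rcases Finset.mem_union.1 (hS hx) with h | h
        · exact Or.inl ⟨hx, h⟩
        · obtain ⟨l, hl, hxl⟩ := Finset.mem_biUnion.1 h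
          refine Or.inr ⟨l, ⟨hl, ?_⟩, hxl⟩
          rcases hfull S hS' hc l (hY hl) with h | h
          · exact h
          · exact absurd hx (Finset.disjoint_left.1 h hxl)

end Blocks

/-! ### Homogeneous block families and the threshold -/

/-- The polynomial with prescribed coefficients in the binomial basis. -/
theorem exists_polynomial_binomial (s : ℕ) (q : ℕ → ℝ) :
    ∃ P : Polynomial ℝ, P.natDegree ≤ s ∧ P.coeff s = q s / s.factorial ∧
      ∀ t : ℕ, P.eval (t : ℝ) = ∑ j ∈ range (s + 1), t.choose j • q j := by
  have hdeg : ∀ j ∈ range (s + 1),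
      (Polynomial.C (q j / j.factorial) * descPochhammer ℝ j).natDegree ≤ s := by
    intro j hj
    refine (Polynomial.natDegree_C_mul_le _ _).trans ?_
    rw [descPochhammer_natDegree]
    have := Finset.mem_range.1 hj
    omega
  refine ⟨∑ j ∈ range (s + 1), Polynomial.C (q j / j.factorial) * descPochhammer ℝ j,
    Polynomial.natDegree_sum_le_of_forall_le _ _ hdeg, ?_, ?_⟩
  · rw [Polynomial.finsetSum_coeff, Finset.sum_range_succ, Finset.sum_eq_zero]
    · have h1 : (descPochhammer ℝ s).coeff s = 1 := by
        have := (monic_descPochhammer ℝ s).coeff_natDegree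
        rwa [descPochhammer_natDegree] at this
      simp [Polynomial.coeff_C_mul, h1]
    · intro j hj
      rw [Polynomial.coeff_C_mul, Polynomial.coeff_eq_zero_of_natDegree_lt, mul_zero]
      rw [descPochhammer_natDegree]
      exact Finset.mem_range.1 hj
  · intro t
    rw [Polynomial.eval_finsetSum]
    refine Finset.sum_congr rfl fun j _ => ?_
    rw [Polynomial.eval_mul, Polynomial.eval_C, descPochhammer_eval_eq_descFactorial,
      Nat.descFactorial_eq_factorial_mul_choose, nsmul_eq_mul]
    have : (j.factorial : ℝ) ≠ 0 := by positivity
    push_cast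
    field_simp

section Homogeneous

variable {α ι : Type} [DecidableEq α] [DecidableEq ι]

/-- `c` lists the coefficients of a polynomial `X ↦ ∑ S ⊆ X, c S` of degree at most `d` on sets,
which takes values in `A` on all sets of size at most `K`. -/
structure IsExpansion (A : Finset ℝ) (d K : ℕ) (c : Finset α → ℝ) : Prop where
  eq_zero : ∀ S, d < #S → c S = 0
  mem : ∀ X, #X ≤ K → ∑ S ∈ X.powerset, c S ∈ A

/-- A homogeneous family of blocks can only be present below the threshold. -/
theorem lt_threshold_of_homogeneous {A : Finset ℝ} {d K e : ℕ} {c : Finset α → ℝ}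
    (hc : IsExpansion A d K c) (he : 1 ≤ e) {R : Finset α} {B : ι → Finset α} {H : Finset ι}
    (hBe : ∀ l ∈ H, #(B l) = e) (hdisj : (H : Set ι).PairwiseDisjoint B)
    (hR : ∀ l ∈ H, Disjoint R (B l)) (hH : K ≤ #H)
    (hhom : ∀ R' ⊆ R, ∀ Y ⊆ H, ∀ Y' ⊆ H, #Y = #Y' → #Y < d + 1 →
      c (R' ∪ Y.biUnion B) = c (R' ∪ Y'.biUnion B))
    (hfull : ∀ S ⊆ R ∪ H.biUnion B, c S ≠ 0 → ∀ l ∈ H, B l ⊆ S ∨ Disjoint (B l) S)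
    (hnz : ∃ R' ⊆ R, ∃ l ∈ H, c (R' ∪ B l) ≠ 0) : K < threshold A d := by
  by_contra hK
  push Not at hK
  have hdK : d ≤ K := le_trans (Nat.le_add_right _ _) hK
  have hcard : ∀ R' ⊆ R, ∀ Y ⊆ H, #(R' ∪ Y.biUnion B) = #R' + #Y * e :=
    fun R' hR' Y hY => card_union_biUnion_blocks hBe hdisj hR hR' hY
  have hbig : ∀ R' ⊆ R, ∀ Y ⊆ H, d < #Y → c (R' ∪ Y.biUnion B) = 0 := by
    intro R' hR' Y hY hlt
    refine hc.eq_zero _ ?_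
    rw [hcard R' hR' Y hY]
    nlinarith
  have hch : ∀ j, ∃ Y, j ≤ #H → Y ⊆ H ∧ #Y = j := fun j => by
    by_cases hj : j ≤ #H
    · obtain ⟨Y, hY⟩ := Finset.exists_subset_card_eq hj
      exact ⟨Y, fun _ => hY⟩
    · exact ⟨∅, fun h => absurd h hj⟩
  choose Yf hYf using hch
  -- The common coefficient of `R'` together with any `j` blocks, read off at the representative `Yf
  -- j`. The default `∅` for `j > #H` plays no role.
  set γ : Finset α → ℕ → ℝ := fun R' j => c (R' ∪ (Yf j).biUnion B) with hγ
  have hcγ : ∀ R' ⊆ R, ∀ Y ⊆ H, c (R' ∪ Y.biUnion B) = γ R' #Y := by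
    intro R' hR' Y hY
    obtain ⟨h1, h2⟩ := hYf #Y (Finset.card_le_card hY)
    by_cases hd : #Y < d + 1
    · exact hhom R' hR' Y hY _ h1 h2.symm hd
    · rw [hbig R' hR' Y hY (by omega)]
      exact (hbig R' hR' _ h1 (by omega)).symm
  have hγbig : ∀ R' ⊆ R, ∀ j ≤ #H, d < j → γ R' j = 0 := by
    intro R' hR' j hj hlt
    obtain ⟨h1, h2⟩ := hYf j hj
    exact hbig R' hR' _ h1 (by omega)
  classical
  set I := (Finset.Icc 1 d).filter (fun s => ∃ R' ⊆ R, γ R' s ≠ 0) with hI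
  have hd1 : 1 ≤ d ∧ ∃ R' ⊆ R, γ R' 1 ≠ 0 := by
    obtain ⟨R', hR', l, hl, hne⟩ := hnz
    have h1 : c (R' ∪ ({l} : Finset ι).biUnion B) ≠ 0 := by rwa [Finset.singleton_biUnion]
    rw [hcγ R' hR' _ (by simpa using hl), Finset.card_singleton] at h1
    refine ⟨?_, R', hR', h1⟩
    by_contra hd0
    exact h1 (hγbig R' hR' 1 (Finset.card_pos.2 ⟨l, hl⟩) (by omega))
  have hIne : I.Nonempty := ⟨1, by simp only [hI, Finset.mem_filter, Finset.mem_Icc]; exact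
    ⟨⟨le_rfl, hd1.1⟩, hd1.2⟩⟩
  obtain ⟨s, hsI, hsmax⟩ := I.exists_max_image id hIne
  obtain ⟨hs, hsex⟩ := Finset.mem_filter.1 hsI
  rw [Finset.mem_Icc] at hs
  have hsH : s ≤ #H := by omega
  -- With `s` maximal and then `R₀` of minimal size, `R₀` is the only one of its subsets
  -- contributing at level `s`. Hence the top coefficient `q s` below is `γ R₀ s ≠ 0`, with no
  -- cancellation.
  obtain ⟨R₀, hR₀, hmin⟩ := (R.powerset.filter (fun R' => γ R' s ≠ 0)).exists_min_image
    (fun R' => #R') (by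
      obtain ⟨R', h, h'⟩ := hsex
      exact ⟨R', Finset.mem_filter.2 ⟨Finset.mem_powerset.2 h, h'⟩⟩)
  obtain ⟨hR₀R, hR₀s⟩ := Finset.mem_filter.1 hR₀
  rw [Finset.mem_powerset] at hR₀R
  have hdeg : #R₀ + s * e ≤ d := by
    by_contra hlt
    obtain ⟨h1, h2⟩ := hYf s hsH
    refine hR₀s (hc.eq_zero _ ?_)
    rw [hcard R₀ hR₀R _ h1, h2]
    omega
  set q : ℕ → ℝ := fun j => ∑ T ∈ R₀.powerset, γ T j with hq
  have hq0 : ∀ j, s < j → j ≤ #H → q j = 0 := by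
    intro j hj hjH
    refine Finset.sum_eq_zero fun T hT => ?_
    have hTR := (Finset.mem_powerset.1 hT).trans hR₀R
    by_cases hjd : j ≤ d
    · by_contra hne
      have := hsmax j (Finset.mem_filter.2 ⟨Finset.mem_Icc.2 ⟨by omega, hjd⟩, T, hTR, hne⟩)
      simp at this
      omega
    · exact hγbig T hTR j hjH (by omega)
  have hqs : q s = γ R₀ s := by
    refine Finset.sum_eq_single_of_mem _ (Finset.mem_powerset_self _) fun T hT hne => ?_
    by_contra hne'
    have hTR := Finset.mem_powerset.1 hT
    have h1 := hmin T (Finset.mem_filter.2 ⟨Finset.mem_powerset.2 (hTR.trans hR₀R), hne'⟩)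
    exact hne (Finset.eq_of_subset_of_card_le hTR h1)
  have hF : ∀ Y ⊆ H, ∑ S ∈ (R₀ ∪ Y.biUnion B).powerset, c S =
      ∑ j ∈ range (s + 1), (#Y).choose j • q j := by
    intro Y hY
    rw [sum_powerset_union_biUnion he hBe hdisj hR hfull hR₀R hY]
    have h1 : ∀ Z ∈ Y.powerset, ∑ T ∈ R₀.powerset, c (T ∪ Z.biUnion B) = q #Z := by
      intro Z hZ
      refine Finset.sum_congr rfl fun T hT => ?_
      exact hcγ T ((Finset.mem_powerset.1 hT).trans hR₀R) Z ((Finset.mem_powerset.1 hZ).trans hY)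
    rw [Finset.sum_congr rfl h1, Finset.sum_powerset_apply_card]
    have hYH := Finset.card_le_card hY
    trans ∑ j ∈ range (#Y + s + 1), (#Y).choose j • q j
    · refine Finset.sum_subset (Finset.range_subset_range.2 (by omega)) fun j _ hj => ?_
      rw [Finset.mem_range] at hj
      rw [Nat.choose_eq_zero_of_lt (by omega), zero_smul]
    · symm
      refine Finset.sum_subset (Finset.range_subset_range.2 (by omega)) fun j _ hj => ?_
      rw [Finset.mem_range] at hj
      by_cases hjY : j ≤ #Y
      · rw [hq0 j (by omega) (by omega), smul_zero]
      · rw [Nat.choose_eq_zero_of_lt (by omega), zero_smul]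
  obtain ⟨P, hPdeg, hPs, hPev⟩ := exists_polynomial_binomial s q
  have hes : e ≤ d / s := (Nat.le_div_iff_mul_le (by omega)).2 (by nlinarith)
  -- From `#R₀ + s * e ≤ d` and `e ≤ d / s`, the left side is at most `d + (d / s) * (W A s - s)`, a
  -- term of the maximum defining the threshold.
  have hW : #R₀ + W A s * e ≤ K := by
    have h1 := le_threshold A hs.1 hs.2
    have h2 : e * (W A s - s) ≤ d / s * (W A s - s) := Nat.mul_le_mul_right _ hes
    have h3 : W A s * e ≤ s * e + e * (W A s - s) := by
      have : W A s ≤ s + (W A s - s) := by omega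
      nlinarith
    omega
  obtain ⟨a, ha⟩ := forcesConstant_W A s P hPdeg (fun i hi => by
    have hie : #R₀ + i * e ≤ K := le_trans (by gcongr) hW
    have hiH : i ≤ #H := by nlinarith
    obtain ⟨h1, h2⟩ := hYf i hiH
    rw [hPev, ← h2, ← hF _ h1]
    exact hc.mem _ (by rw [hcard R₀ hR₀R _ h1, h2]; exact hie))
  rw [ha, Polynomial.coeff_C, if_neg (by omega)] at hPs
  have : (s.factorial : ℝ) ≠ 0 := by positivity
  rw [eq_comm, div_eq_zero_iff, hqs] at hPs
  exact hPs.elim hR₀s this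

end Homogeneous

/-! ### Bounding the number of variables of an expansion -/

/-- Classify each block by its trace `T ⊆ R` and the size of its proper fragment `B`. Within one
class the fragments are disjoint blocks of a smaller size over the same `T`, so the bound `N₀`
applies; there are at most `2 ^ #R * e` classes. -/
theorem block_sdiff_bound {A : Finset ℝ} {d K e N₀ : ℕ}
    (hN₀ : ∀ e', 1 ≤ e' → e' < e → ∀ {α : Type} [DecidableEq α] (c : Finset α → ℝ),
      IsExpansion A d K c → ∀ (R : Finset α) (𝓑 : Finset (Finset α)),
      (∀ B ∈ 𝓑, #B = e' ∧ Disjoint R B ∧ c (R ∪ B) ≠ 0) →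
      (𝓑 : Set (Finset α)).PairwiseDisjoint id → #𝓑 ≤ N₀)
    {α : Type} [DecidableEq α] {c : Finset α → ℝ} (hc : IsExpansion A d K c)
    {R : Finset α} {𝓑 : Finset (Finset α)} (hcard : ∀ B ∈ 𝓑, #B = e)
    (hR : ∀ B ∈ 𝓑, Disjoint R B) (hdisj : (𝓑 : Set (Finset α)).PairwiseDisjoint id)
    (hbad : ∀ y ∈ 𝓑, ∃ T ⊆ R, ∃ B ⊆ y, B.Nonempty ∧ B ≠ y ∧ c (T ∪ B) ≠ 0) :
    #𝓑 ≤ 2 ^ #R * (e * N₀) := by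
  choose! T hTR B hBy hBne hBy' hcB using hbad
  have hBcard : ∀ y ∈ 𝓑, 1 ≤ #(B y) ∧ #(B y) < e := fun y hy =>
    ⟨Finset.card_pos.2 (hBne y hy), by
      rw [← hcard y hy]
      exact Finset.card_lt_card ((hBy y hy).ssubset_of_ne (hBy' y hy))⟩
  have hmaps : ∀ y ∈ 𝓑, (T y, #(B y)) ∈ R.powerset ×ˢ range e := fun y hy => by
    rw [Finset.mem_product, Finset.mem_powerset, Finset.mem_range]
    exact ⟨hTR y hy, (hBcard y hy).2⟩
  have hfib : ∀ p ∈ R.powerset ×ˢ range e, #{y ∈ 𝓑 | (T y, #(B y)) = p} ≤ N₀ := by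
    rintro ⟨T', e'⟩ -
    set 𝓕 := {y ∈ 𝓑 | (T y, #(B y)) = (T', e')} with h𝓕
    have hF : ∀ y ∈ 𝓕, y ∈ 𝓑 ∧ T y = T' ∧ #(B y) = e' := fun y hy => by
      rw [h𝓕, Finset.mem_filter, Prod.mk.injEq] at hy
      exact hy
    have hBdisj : ∀ y ∈ 𝓕, ∀ z ∈ 𝓕, y ≠ z → Disjoint (B y) (B z) := fun y hy z hz hyz =>
      (hdisj (hF y hy).1 (hF z hz).1 hyz).mono (hBy y (hF y hy).1) (hBy z (hF z hz).1)
    have hinj : Set.InjOn B 𝓕 := by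
      intro y hy z hz hyz
      by_contra hne
      have h1 := hBdisj y hy z hz hne
      rw [← hyz, Finset.disjoint_self_iff_empty] at h1
      exact (hBne y (hF y hy).1).ne_empty h1
    rw [← Finset.card_image_of_injOn hinj]
    rcases 𝓕.eq_empty_or_nonempty with h0 | ⟨y₀, hy₀⟩
    · simp [h0]
    have he' := hBcard y₀ (hF y₀ hy₀).1
    rw [(hF y₀ hy₀).2.2] at he'
    refine hN₀ e' he'.1 he'.2 c hc T' _ ?_ ?_
    · intro Z hZ
      obtain ⟨y, hy, rfl⟩ := Finset.mem_image.1 hZ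
      obtain ⟨h1, h2, h3⟩ := hF y hy
      exact ⟨h3, (hR y h1).mono (h2 ▸ hTR y h1) (hBy y h1), h2 ▸ hcB y h1⟩
    · intro Z hZ Z' hZ' hne
      obtain ⟨y, hy, rfl⟩ := Finset.mem_image.1 (Finset.mem_coe.1 hZ)
      obtain ⟨z, hz, rfl⟩ := Finset.mem_image.1 (Finset.mem_coe.1 hZ')
      exact hBdisj y hy z hz (fun h => hne (h ▸ rfl))
  refine (Finset.card_le_mul_card_image_of_maps_to hmaps N₀ hfib).trans_eq ?_
  rw [Finset.card_product, Finset.card_powerset, Finset.card_range]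
  ring

/-- A coefficient is an iterated difference of values in `A`, so it lies in a finite set independent
of `c` and of the ground set. This makes coefficients usable as Ramsey colours. -/
theorem exists_finset_mem (A : Finset ℝ) (d K : ℕ) (hdK : d ≤ K) :
    ∃ C : Finset ℝ, ∀ {α : Type} [DecidableEq α] (c : Finset α → ℝ), IsExpansion A d K c →
      ∀ S, c S ∈ C := by
  classical
  let Z : ℕ → Finset ℝ := fun m => Nat.rec A (fun _ C => Finset.image₂ (· - ·) C C) m
  have hZ : ∀ {α : Type} [DecidableEq α] (c : Finset α → ℝ), IsExpansion A d K c →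
      ∀ S X, Disjoint S X → #S + #X ≤ K → ∑ V ∈ X.powerset, c (S ∪ V) ∈ Z #S := by
    intro α _ c hc S
    induction S using Finset.induction_on with
    | empty =>
      intro X _ hX
      have := hc.mem X (by simpa using hX)
      simp only [Finset.empty_union]
      exact this
    | insert a S ha ih =>
      intro X hdisj hX
      rw [Finset.card_insert_of_notMem ha] at hX ⊢
      rw [Finset.disjoint_insert_left] at hdisj
      have h1 := ih (insert a X) (by
        rw [Finset.disjoint_insert_right]; exact ⟨ha, hdisj.2⟩)
        (by rw [Finset.card_insert_of_notMem hdisj.1]; omega)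
      have h2 := ih X hdisj.2 (by omega)
      rw [Finset.sum_powerset_insert hdisj.1] at h1
      refine Finset.mem_image₂.2 ⟨_, h1, _, h2, ?_⟩
      rw [add_sub_cancel_left]
      refine Finset.sum_congr rfl fun V _ => ?_
      rw [Finset.union_insert, Finset.insert_union]
  refine ⟨insert 0 ((range (d + 1)).biUnion Z), fun c hc S => ?_⟩
  by_cases hS : #S ≤ d
  · refine Finset.mem_insert_of_mem (Finset.mem_biUnion.2 ⟨#S, Finset.mem_range.2 (by omega), ?_⟩)
    simpa using hZ c hc S ∅ (Finset.disjoint_empty_right _) (by simpa using hS.trans hdK)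
  · rw [hc.eq_zero S (by omega)]
    exact Finset.mem_insert_self _ _

theorem card_le_card_of_forall_not_disjoint {α : Type} [DecidableEq α] {Y : Finset (Finset α)}
    (hdisj : (Y : Set (Finset α)).PairwiseDisjoint id) {S : Finset α}
    (hS : ∀ y ∈ Y, ¬ Disjoint y S) : #Y ≤ #S := by
  have h1 : #(Y.biUnion (fun y => y ∩ S)) = ∑ y ∈ Y, #(y ∩ S) :=
    Finset.card_biUnion fun y hy z hz hyz =>
      (hdisj hy hz hyz).mono inter_subset_left inter_subset_left
  calc #Y = ∑ y ∈ Y, 1 := by simp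
    _ ≤ ∑ y ∈ Y, #(y ∩ S) := Finset.sum_le_sum fun y hy => by
        rw [Nat.one_le_iff_ne_zero, Ne, Finset.card_eq_zero, ← Finset.disjoint_iff_inter_eq_empty]
        exact hS y hy
    _ = #(Y.biUnion (fun y => y ∩ S)) := h1.symm
    _ ≤ #S := Finset.card_le_card (Finset.biUnion_subset.2 fun y _ => inter_subset_right)

/-- A family of `i + 1`-element sets, each of which has an element lying in a small set determined
by the other elements, cannot contain all subsets of a large set. -/
theorem card_le_of_forall_exists_mem {β : Type} [DecidableEq β] (H : Finset β) (i m : ℕ)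
    (Φ : Finset β → Finset β) (hΦ : ∀ Y ⊆ H, #Y = i → #(Φ Y) ≤ m)
    (h : ∀ Y ⊆ H, #Y = i + 1 → ∃ y ∈ Y, y ∈ Φ (Y.erase y)) : #H ≤ m * (i + 1) + i := by
  -- Each `i + 1`-set arises from an `i`-set in at most `m` ways, so `choose (#H) (i + 1) ≤ m *
  -- choose (#H) i`, which means `#H - i ≤ m * (i + 1)`.
  have hsub : H.powersetCard (i + 1) ⊆
      (H.powersetCard i).biUnion (fun Y => (Φ Y).image (fun y => insert y Y)) := by
    intro Y hY
    rw [Finset.mem_powersetCard] at hY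
    obtain ⟨y, hy, hyΦ⟩ := h Y hY.1 hY.2
    refine Finset.mem_biUnion.2 ⟨Y.erase y, ?_, Finset.mem_image.2 ⟨y, hyΦ, Finset.insert_erase hy⟩⟩
    rw [Finset.mem_powersetCard, Finset.card_erase_of_mem hy]
    exact ⟨(Finset.erase_subset _ _).trans hY.1, by omega⟩
  have hle := (Finset.card_le_card hsub).trans (Finset.card_biUnion_le_card_mul _ _ m fun Y hY => by
    rw [Finset.mem_powersetCard] at hY
    exact Finset.card_image_le.trans (hΦ Y hY.1 hY.2))
  rw [Finset.card_powersetCard, Finset.card_powersetCard] at hle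
  by_contra hlt
  push Not at hlt
  have h1 := Nat.choose_succ_right_eq (#H) i
  have h2 : 0 < (#H).choose i := Nat.choose_pos (by omega)
  have h3 : (#H).choose i * (#H - i) ≤ (#H).choose i * (m * (i + 1)) := by
    rw [← h1, ← mul_assoc]
    exact Nat.mul_le_mul_right _ hle
  have := Nat.le_of_mul_le_mul_left h3 h2
  omega

/-- Strong induction on `e`: the bounds for smaller blocks show that, in a Ramsey-homogeneous
subfamily, no monomial cuts a block properly. Then `lt_threshold_of_homogeneous` applies. -/
theorem exists_block_bound {A : Finset ℝ} {d K : ℕ} (hK : threshold A d ≤ K) (e : ℕ) (he : 1 ≤ e) :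
    ∃ N, ∀ {α : Type} [DecidableEq α] (c : Finset α → ℝ),
      IsExpansion A d K c → ∀ (R : Finset α) (𝓑 : Finset (Finset α)),
      (∀ B ∈ 𝓑, #B = e ∧ Disjoint R B ∧ c (R ∪ B) ≠ 0) →
      (𝓑 : Set (Finset α)).PairwiseDisjoint id → #𝓑 ≤ N := by
  have hdK : d ≤ K := le_trans (Nat.le_add_right _ _) hK
  induction e using Nat.strong_induction_on with
  | _ e ih =>
  obtain ⟨N₀, hN₀⟩ : ∃ N₀, ∀ e', 1 ≤ e' → e' < e →
      ∀ {α : Type} [DecidableEq α] (c : Finset α → ℝ),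
      IsExpansion A d K c → ∀ (R : Finset α) (𝓑 : Finset (Finset α)),
      (∀ B ∈ 𝓑, #B = e' ∧ Disjoint R B ∧ c (R ∪ B) ≠ 0) →
      (𝓑 : Set (Finset α)).PairwiseDisjoint id → #𝓑 ≤ N₀ := by
    choose! N hN using ih
    refine ⟨∑ e' ∈ range e, N e', fun e' h1 h2 α _ c hc R 𝓑 h𝓑 hd => ?_⟩
    exact (hN e' h2 h1 c hc R 𝓑 h𝓑 hd).trans
      (Finset.single_le_sum (f := N) (fun _ _ => Nat.zero_le _) (Finset.mem_range.2 h2))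
  obtain ⟨C, hC⟩ := exists_finset_mem A d K hdK
  -- `m` is the bound of `block_sdiff_bound` over a base `R ∪ Y.biUnion id` with at most `d + d * e`
  -- points. The colour of `Y` records the coefficients on all `R' ∪ Y.biUnion id` and one bit,
  -- whether `Y` is bad. The size demanded of `H` covers `K` and exceeds the counting bound `m * (i
  -- + 1) + i` for `i < d`.
  set m := 2 ^ (d + d * e) * (e * N₀) with hm
  obtain ⟨M, hM⟩ := exists_homogeneous ((#C + 1) ^ 2 ^ d * 2) (d + 1) (K + m * (d + 1) + d + 1)
  refine ⟨M, fun {α} _ c hc R 𝓑 h𝓑 hdisj => ?_⟩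
  by_contra hlt
  push Not at hlt
  obtain ⟨B₀, hB₀⟩ : 𝓑.Nonempty := Finset.card_pos.1 (by omega)
  have hRd : #R + e ≤ d := by
    obtain ⟨h1, h2, h3⟩ := h𝓑 B₀ hB₀
    rw [← h1, ← Finset.card_union_of_disjoint h2]
    by_contra h
    exact h3 (hc.eq_zero _ (by omega))
  let bad : Finset (Finset α) → Prop := fun Y =>
    ∃ S ⊆ R ∪ Y.biUnion id, c S ≠ 0 ∧ (∀ y ∈ Y, ¬ Disjoint y S) ∧ ∃ y ∈ Y, ¬ y ⊆ S
  classical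
  obtain ⟨H, hH, hHc, hcol⟩ := hM (κ := (R.powerset → C) × Bool) 𝓑 hlt.le (by
      rw [Fintype.card_prod, Fintype.card_bool, Fintype.card_fun, Fintype.card_coe,
        Fintype.card_coe, Finset.card_powerset]
      refine Nat.mul_le_mul_right _ ?_
      calc #C ^ 2 ^ #R ≤ (#C + 1) ^ 2 ^ #R := Nat.pow_le_pow_left (by omega) _
        _ ≤ (#C + 1) ^ 2 ^ d :=
          Nat.pow_le_pow_right (by omega) (Nat.pow_le_pow_right (by omega) (by omega)))
    (fun Y => (fun R' => ⟨c (R' ∪ Y.biUnion id), hC c hc _⟩, decide (bad Y)))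
  have hHe : ∀ B ∈ H, #B = e := fun B hB => (h𝓑 B (hH hB)).1
  have hHR : ∀ B ∈ H, Disjoint R B := fun B hB => (h𝓑 B (hH hB)).2.1
  have hHd : (H : Set (Finset α)).PairwiseDisjoint id :=
    hdisj.subset (Finset.coe_subset.2 hH)
  have hnotbad : ∀ Y ⊆ H, #Y < d + 1 → ¬ bad Y := by
    intro Y₀ hY₀ hY₀c hbad₀
    have hall : ∀ Y ⊆ H, #Y = #Y₀ → bad Y := by
      intro Y hY hYc
      have := congrArg Prod.snd (hcol Y hY Y₀ hY₀ hYc (by omega))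
      simpa [hbad₀] using this
    obtain ⟨i, hi⟩ : ∃ i, #Y₀ = i + 1 := by
      obtain ⟨S, -, -, -, y, hy, -⟩ := hbad₀
      exact ⟨#Y₀ - 1, by have := Finset.card_pos.2 ⟨y, hy⟩; omega⟩
    -- Blocks cut properly by a monomial otherwise supported on `R` and the blocks of `Y`. If one
    -- set of a given size is bad then all are, and each bad set has a block in `Φ` of the rest,
    -- contradicting the count.
    let Φ : Finset (Finset α) → Finset (Finset α) := fun Y => (H \ Y).filter fun y =>
      ∃ T ⊆ R ∪ Y.biUnion id, ∃ B ⊆ y, B.Nonempty ∧ B ≠ y ∧ c (T ∪ B) ≠ 0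
    have hle := card_le_of_forall_exists_mem H i m Φ ?_ ?_
    · have : m * (i + 1) ≤ m * (d + 1) := Nat.mul_le_mul_left _ (by omega)
      omega
    · intro Y hY hYc
      have hΦH : ∀ y ∈ Φ Y, y ∈ H ∧ y ∉ Y := fun y hy =>
        Finset.mem_sdiff.1 (Finset.mem_filter.1 hy).1
      have h1 := block_sdiff_bound hN₀ hc (R := R ∪ Y.biUnion id) (𝓑 := Φ Y)
        (fun B hB => hHe B (hΦH B hB).1) (fun B hB => by
          rw [Finset.disjoint_union_left, Finset.disjoint_biUnion_left]
          refine ⟨hHR B (hΦH B hB).1, fun y hy => ?_⟩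
          exact hHd (hY hy) (hΦH B hB).1 (fun h => (hΦH B hB).2 (h ▸ hy)))
        (hHd.subset fun y hy => (hΦH y hy).1) (fun y hy => (Finset.mem_filter.1 hy).2)
      refine h1.trans (Nat.mul_le_mul_right _ (Nat.pow_le_pow_right (by omega) ?_))
      rw [card_union_biUnion_blocks (B := id) hHe hHd hHR subset_rfl hY]
      exact Nat.add_le_add (by omega) (Nat.mul_le_mul_right _ (by omega))
    · intro Y hY hYc
      obtain ⟨S, hS, hcS, hmeet, y, hy, hyS⟩ := hall Y hY (by omega)
      refine ⟨y, hy, Finset.mem_filter.2 ⟨?_, S \ y, ?_, S ∩ y, inter_subset_right, ?_, ?_, ?_⟩⟩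
      · exact Finset.mem_sdiff.2 ⟨hY hy, Finset.notMem_erase _ _⟩
      · intro x hx
        obtain ⟨hxS, hxy⟩ := Finset.mem_sdiff.1 hx
        rcases Finset.mem_union.1 (hS hxS) with h | h
        · exact Finset.mem_union_left _ h
        · obtain ⟨z, hz, hxz⟩ := Finset.mem_biUnion.1 h
          refine Finset.mem_union_right _ (Finset.mem_biUnion.2 ⟨z, ?_, hxz⟩)
          exact Finset.mem_erase.2 ⟨fun h => hxy (h ▸ hxz), hz⟩
      · rw [Finset.nonempty_iff_ne_empty, Ne, ← Finset.disjoint_iff_inter_eq_empty, disjoint_comm]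
        exact hmeet y hy
      · exact fun h => hyS (h ▸ inter_subset_left)
      · rwa [Finset.sdiff_union_inter]
  refine absurd hK (not_le.2 (lt_threshold_of_homogeneous hc he (B := id) hHe hHd hHR (by omega)
    ?_ ?_ ?_))
  · intro R' hR' Y hY Y' hY' hYY hlt
    have := congrFun (congrArg Prod.fst (hcol Y hY Y' hY' hYY hlt)) ⟨R', Finset.mem_powerset.2 hR'⟩
    exact congrArg Subtype.val this
  · intro S hS hcS l hl
    by_contra hcon
    push Not at hcon
    -- The disjoint blocks met by `S` number at most `#S ≤ d`, so this `Y` lies in the range where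
    -- badness is excluded.
    set Y := H.filter (fun y => ¬ Disjoint y S) with hY
    have hYH : Y ⊆ H := Finset.filter_subset _ _
    have hmeet : ∀ y ∈ Y, ¬ Disjoint y S := fun y hy => (Finset.mem_filter.1 hy).2
    have hYc : #Y ≤ #S :=
      card_le_card_of_forall_not_disjoint (hHd.subset (Finset.coe_subset.2 hYH)) hmeet
    have hSd : #S ≤ d := by
      by_contra h
      exact hcS (hc.eq_zero S (by omega))
    refine hnotbad Y hYH (by omega) ⟨S, ?_, hcS, hmeet, l, Finset.mem_filter.2 ⟨hl, hcon.2⟩, hcon.1⟩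
    intro x hx
    rcases Finset.mem_union.1 (hS hx) with h | h
    · exact Finset.mem_union_left _ h
    · obtain ⟨z, hz, hxz⟩ := Finset.mem_biUnion.1 h
      refine Finset.mem_union_right _ (Finset.mem_biUnion.2 ⟨z, Finset.mem_filter.2 ⟨hz, ?_⟩, hxz⟩)
      exact fun h => Finset.disjoint_left.1 h hxz hx
  · obtain ⟨l, hl⟩ : H.Nonempty := Finset.card_pos.1 (by omega)
    exact ⟨R, subset_rfl, l, hl, (h𝓑 l (hH hl)).2.2⟩

theorem exists_maximal_disjoint {α : Type} [DecidableEq α] (𝓑 : Finset (Finset α)) :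
    ∃ 𝓜 ⊆ 𝓑, (𝓜 : Set (Finset α)).PairwiseDisjoint id ∧
      ∀ B ∈ 𝓑, B.Nonempty → ¬ Disjoint B (𝓜.biUnion id) := by
  classical
  obtain ⟨𝓜, h𝓜, hmax⟩ := (𝓑.powerset.filter
    (fun 𝓜 : Finset (Finset α) => (𝓜 : Set (Finset α)).PairwiseDisjoint id)).exists_max_image
    (fun 𝓜 => #𝓜)
    ⟨∅, by simp⟩
  rw [Finset.mem_filter, Finset.mem_powerset] at h𝓜
  refine ⟨𝓜, h𝓜.1, h𝓜.2, fun B hB hne hd => ?_⟩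
  rw [Finset.disjoint_biUnion_right] at hd
  have hBM : B ∉ 𝓜 := fun h => hne.ne_empty ((Finset.disjoint_self_iff_empty B).1 (hd B h))
  have := hmax (insert B 𝓜) (by
    rw [Finset.mem_filter, Finset.mem_powerset]
    refine ⟨Finset.insert_subset hB h𝓜.1, ?_⟩
    rw [Finset.coe_insert]
    exact h𝓜.2.insert fun C hC _ => hd C hC)
  rw [Finset.card_insert_of_notMem hBM] at this
  omega

/-- Every `S \ T` meets the union of a maximal disjoint subfamily, which has at most `N * (e + 1)`
points. Adding the common point to `T` lowers `e` by one. -/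
theorem exists_card_superset_bound {A : Finset ℝ} {d K : ℕ} (hK : threshold A d ≤ K) (e : ℕ) :
    ∃ G, ∀ {α : Type} [DecidableEq α] (c : Finset α → ℝ), IsExpansion A d K c →
      ∀ (T : Finset α) (𝓢 : Finset (Finset α)),
      (∀ S ∈ 𝓢, T ⊆ S ∧ #S = #T + e ∧ c S ≠ 0) → #𝓢 ≤ G := by
  induction e with
  | zero =>
    refine ⟨1, fun c _ T 𝓢 h𝓢 => ?_⟩
    refine Finset.card_le_one.2 fun S hS S' hS' => ?_
    rw [← Finset.eq_of_subset_of_card_le (h𝓢 S hS).1 (h𝓢 S hS).2.1.le,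
      ← Finset.eq_of_subset_of_card_le (h𝓢 S' hS').1 (h𝓢 S' hS').2.1.le]
  | succ e ih =>
    obtain ⟨G, hG⟩ := ih
    obtain ⟨N, hN⟩ := exists_block_bound hK (e + 1) (by omega)
    refine ⟨N * (e + 1) * G, fun {α} _ c hc T 𝓢 h𝓢 => ?_⟩
    obtain ⟨𝓜, h𝓜, hdisj, hmax⟩ := exists_maximal_disjoint (𝓢.image (· \ T))
    have hlink : ∀ B ∈ 𝓢.image (· \ T), #B = e + 1 ∧ Disjoint T B ∧ c (T ∪ B) ≠ 0 := by
      intro B hB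
      obtain ⟨S, hS, rfl⟩ := Finset.mem_image.1 hB
      obtain ⟨h1, h2, h3⟩ := h𝓢 S hS
      refine ⟨?_, Finset.disjoint_sdiff, ?_⟩
      · rw [Finset.card_sdiff_of_subset h1]; omega
      · rwa [Finset.union_sdiff_of_subset h1]
    have hM : #𝓜 ≤ N := hN c hc T 𝓜 (fun B hB => hlink B (h𝓜 hB)) hdisj
    have hV : #(𝓜.biUnion id) ≤ N * (e + 1) :=
      (Finset.card_biUnion_le_card_mul _ _ (e + 1) fun B hB => (hlink B (h𝓜 hB)).1.le).trans
        (Nat.mul_le_mul_right _ hM)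
    have hsub : 𝓢 ⊆ (𝓜.biUnion id).biUnion (fun x => 𝓢.filter (x ∈ ·)) := by
      intro S hS
      have hB : S \ T ∈ 𝓢.image (· \ T) := Finset.mem_image_of_mem _ hS
      have h1 := hmax _ hB (Finset.card_pos.1 (by rw [(hlink _ hB).1]; omega))
      obtain ⟨x, hx, hx'⟩ := Finset.not_disjoint_iff.1 h1
      exact Finset.mem_biUnion.2 ⟨x, hx', Finset.mem_filter.2 ⟨hS, (Finset.mem_sdiff.1 hx).1⟩⟩
    refine (Finset.card_le_card hsub).trans ((Finset.card_biUnion_le_card_mul _ _ G ?_).trans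
      (Nat.mul_le_mul_right _ hV))
    intro x hx
    obtain ⟨B, hB, hxB⟩ := Finset.mem_biUnion.1 hx
    have hxT : x ∉ T := Finset.disjoint_right.1 (hlink B (h𝓜 hB)).2.1 hxB
    refine hG c hc (insert x T) _ fun S hS => ?_
    obtain ⟨hS, hxS⟩ := Finset.mem_filter.1 hS
    obtain ⟨h1, h2, h3⟩ := h𝓢 S hS
    refine ⟨Finset.insert_subset hxS h1, ?_, h3⟩
    rw [Finset.card_insert_of_notMem hxT]
    omega

/-- Above the threshold, only boundedly many variables appear in an expansion. -/
theorem exists_card_vars_bound {A : Finset ℝ} {d K : ℕ} (hK : threshold A d ≤ K) :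
    ∃ G, ∀ {α : Type} [DecidableEq α] (c : Finset α → ℝ), IsExpansion A d K c →
      ∀ V : Finset α, (∀ v ∈ V, ∃ S, v ∈ S ∧ c S ≠ 0) → #V ≤ G := by
  choose G hG using exists_card_superset_bound hK
  refine ⟨(∑ e ∈ range (d + 1), G e) * d, fun {α} _ c hc V hV => ?_⟩
  choose! S hvS hcS using hV
  have hSd : ∀ v ∈ V, #(S v) ≤ d := fun v hv => by
    by_contra h
    exact hcS v hv (hc.eq_zero _ (by omega))
  have hsub : V ⊆ (V.image S).biUnion id := fun v hv =>
    Finset.mem_biUnion.2 ⟨S v, Finset.mem_image_of_mem _ hv, hvS v hv⟩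
  have hS𝓢 : V.image S ⊆ (range (d + 1)).biUnion (fun e => (V.image S).filter (#· = e)) := by
    intro T hT
    obtain ⟨v, hv, rfl⟩ := Finset.mem_image.1 hT
    have := hSd v hv
    exact Finset.mem_biUnion.2 ⟨#(S v), Finset.mem_range.2 (by omega),
      Finset.mem_filter.2 ⟨hT, rfl⟩⟩
  have hcount : #(V.image S) ≤ ∑ e ∈ range (d + 1), G e := by
    refine (Finset.card_le_card hS𝓢).trans (Finset.card_biUnion_le.trans
      (Finset.sum_le_sum fun e _ => hG e c hc ∅ _ fun T hT => ?_))
    obtain ⟨h1, h2⟩ := Finset.mem_filter.1 hT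
    obtain ⟨v, hv, rfl⟩ := Finset.mem_image.1 h1
    exact ⟨Finset.empty_subset _, by simpa using h2, hcS v hv⟩
  refine (Finset.card_le_card hsub).trans ((Finset.card_biUnion_le_card_mul _ _ d ?_).trans
    (Nat.mul_le_mul_right _ hcount))
  intro T hT
  obtain ⟨v, hv, rfl⟩ := Finset.mem_image.1 hT
  exact hSd v hv

/-! ### Iterated differences along disjoint pairs -/

section PairDiff

variable {α : Type} [DecidableEq α]

/-- Iterated difference of `f` along a list of pairs of points. -/
def pairDiff (f : Finset α → ℝ) : List (α × α) → Finset α → ℝ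
  | [], Y => f Y
  | p :: L, Y => pairDiff f L (insert p.1 Y) - pairDiff f L (insert p.2 Y)

/-- The set of points occurring in a list of pairs. -/
def pairSupport : List (α × α) → Finset α
  | [] => ∅
  | p :: L => insert p.1 (insert p.2 (pairSupport L))

/-- The points occurring in a list of pairs are all distinct. -/
def IsMatching : List (α × α) → Prop
  | [] => True
  | p :: L => p.1 ≠ p.2 ∧ p.1 ∉ pairSupport L ∧ p.2 ∉ pairSupport L ∧ IsMatching L

theorem mem_pairSupport {L : List (α × α)} {x : α} :
    x ∈ pairSupport L ↔ ∃ p ∈ L, x = p.1 ∨ x = p.2 := by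
  induction L with
  | nil => simp [pairSupport]
  | cons p L ih => simp [pairSupport, ih, or_assoc]

theorem card_pairSupport_le (L : List (α × α)) : #(pairSupport L) ≤ 2 * L.length := by
  induction L with
  | nil => simp [pairSupport]
  | cons p L ih =>
    have h1 := Finset.card_insert_le p.1 (insert p.2 (pairSupport L))
    have h2 := Finset.card_insert_le p.2 (pairSupport L)
    simp only [pairSupport, List.length_cons]
    omega

theorem IsMatching.length_le {L : List (α × α)} (hL : IsMatching L) {S : Finset α}
    (hS : ∀ p ∈ L, p.1 ∈ S ∨ p.2 ∈ S) : L.length ≤ #(S ∩ pairSupport L) := by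
  induction L with
  | nil => simp
  | cons p L ih =>
    obtain ⟨-, h1, h2, h3⟩ := hL
    have ih' := ih h3 fun q hq => hS q (List.mem_cons_of_mem _ hq)
    obtain ⟨x, hxS, hxp, hxL⟩ : ∃ x ∈ S, (x = p.1 ∨ x = p.2) ∧ x ∉ pairSupport L := by
      rcases hS p List.mem_cons_self with h | h
      · exact ⟨_, h, Or.inl rfl, h1⟩
      · exact ⟨_, h, Or.inr rfl, h2⟩
    have hsub : insert x (S ∩ pairSupport L) ⊆ S ∩ pairSupport (p :: L) := by
      refine Finset.insert_subset ?_ (Finset.inter_subset_inter_left ?_)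
      · rw [Finset.mem_inter, mem_pairSupport]
        exact ⟨hxS, p, List.mem_cons_self, hxp⟩
      · exact (Finset.subset_insert _ _).trans (Finset.subset_insert _ _)
    have := Finset.card_le_card hsub
    rw [Finset.card_insert_of_notMem (fun h => hxL (Finset.mem_inter.1 h).2)] at this
    simp only [List.length_cons]
    omega

theorem pairDiff_sum {β : Type} (s : Finset β) (a : β → ℝ) (g : β → Finset α → ℝ)
    (L : List (α × α)) (Y : Finset α) :
    pairDiff (fun X => ∑ b ∈ s, a b * g b X) L Y = ∑ b ∈ s, a b * pairDiff (g b) L Y := by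
  induction L generalizing Y with
  | nil => rfl
  | cons p L ih =>
    simp only [pairDiff, ih]
    rw [← Finset.sum_sub_distrib]
    exact Finset.sum_congr rfl fun b _ => by ring

theorem pairDiff_monomial_congr (S : Finset α) (L : List (α × α)) {Y Y' : Finset α}
    (h : S ∩ Y = S ∩ Y') :
    pairDiff (fun X => if S ⊆ X then (1 : ℝ) else 0) L Y =
      pairDiff (fun X => if S ⊆ X then (1 : ℝ) else 0) L Y' := by
  induction L generalizing Y Y' with
  | nil =>
    have hiff : S ⊆ Y ↔ S ⊆ Y' := by
      rw [← Finset.inter_eq_left, ← Finset.inter_eq_left (t := Y'), h]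
    simp only [pairDiff, hiff]
  | cons p L ih =>
    have hins : ∀ x, S ∩ insert x Y = S ∩ insert x Y' := fun x => by
      by_cases hx : x ∈ S
      · rw [Finset.inter_insert_of_mem hx, Finset.inter_insert_of_mem hx, h]
      · rw [Finset.inter_insert_of_notMem hx, Finset.inter_insert_of_notMem hx, h]
    simp only [pairDiff]
    rw [ih (hins p.1), ih (hins p.2)]

theorem pairDiff_monomial_eq_zero {S : Finset α} {L : List (α × α)}
    (h : ∃ p ∈ L, p.1 ∉ S ∧ p.2 ∉ S) (Y : Finset α) :
    pairDiff (fun X => if S ⊆ X then (1 : ℝ) else 0) L Y = 0 := by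
  induction L generalizing Y with
  | nil => simp at h
  | cons q L ih =>
    obtain ⟨p, hp, hp1, hp2⟩ := h
    simp only [pairDiff]
    rcases List.mem_cons.1 hp with rfl | hp
    · rw [sub_eq_zero]
      refine pairDiff_monomial_congr S L ?_
      rw [Finset.inter_insert_of_notMem hp1, Finset.inter_insert_of_notMem hp2]
    · rw [ih ⟨p, hp, hp1, hp2⟩, ih ⟨p, hp, hp1, hp2⟩, sub_zero]

/-- All iterated differences of order more than `d` along disjoint pairs vanish. -/
def HasPairDegree (d : ℕ) (f : Finset α → ℝ) : Prop :=
  ∀ L : List (α × α), IsMatching L → d < L.length → ∀ Y, pairDiff f L Y = 0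

/-- On indicators a monomial depends only on its support. With at most `d` variables it misses both
points of one of more than `d` disjoint pairs, and the difference along that pair kills it. -/
theorem hasPairDegree_eval {d : ℕ} (P : MvPolynomial α ℝ) (hP : P.totalDegree ≤ d) :
    HasPairDegree d (fun X => MvPolynomial.eval (fun i => if i ∈ X then (1 : ℝ) else 0) P) := by
  intro L hL hd Y
  have heq : (fun X : Finset α => MvPolynomial.eval (fun i => if i ∈ X then (1 : ℝ) else 0) P) =
      fun X => ∑ m ∈ P.support, P.coeff m * (if m.support ⊆ X then (1 : ℝ) else 0) := by
    funext X
    rw [MvPolynomial.eval_eq]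
    refine Finset.sum_congr rfl fun m _ => ?_
    congr 1
    split_ifs with h
    · exact Finset.prod_eq_one fun i hi => by simp [h hi]
    · obtain ⟨i, hi, hiX⟩ := Finset.not_subset.1 h
      refine Finset.prod_eq_zero hi ?_
      rw [if_neg hiX, zero_pow (Finsupp.mem_support_iff.1 hi)]
  rw [heq, pairDiff_sum]
  refine Finset.sum_eq_zero fun m hm => ?_
  rw [pairDiff_monomial_eq_zero, mul_zero]
  by_contra hcon
  push Not at hcon
  have h1 := hL.length_le (S := m.support) fun p hp => by
    by_cases hp1 : p.1 ∈ m.support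
    · exact Or.inl hp1
    · exact Or.inr (hcon p hp hp1)
  have h2 : #(m.support) ≤ m.sum fun _ e => e := by
    rw [Finsupp.sum, Finset.card_eq_sum_ones]
    exact Finset.sum_le_sum fun i hi => Nat.one_le_iff_ne_zero.2 (Finsupp.mem_support_iff.1 hi)
  have h3 := MvPolynomial.le_totalDegree hm
  have h4 := Finset.card_le_card (Finset.inter_subset_left (s₁ := m.support) (s₂ := pairSupport L))
  omega

/-- Two sets of equal size and equal trace on `U` are joined by exchanges of single points outside
`U`. -/
theorem eq_of_exchange {f : Finset α → ℝ} {U V : Finset α} {k : ℕ}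
    (h : ∀ Y i j, #Y + 1 = k → Y ∩ U = V → i ∉ U → j ∉ U → i ∉ Y → j ∉ Y → i ≠ j →
      f (insert i Y) = f (insert j Y)) (X X' : Finset α) (hX : #X = k) (hX' : #X' = k)
    (hXU : X ∩ U = V) (hXU' : X' ∩ U = V) : f X = f X' := by
  induction hm : #(X \ X') generalizing X with
  | zero =>
    rw [Finset.card_eq_zero, Finset.sdiff_eq_empty_iff_subset] at hm
    rw [Finset.eq_of_subset_of_card_le hm (by omega)]
  | succ m ih =>
    obtain ⟨i, hi⟩ := Finset.card_pos.1 (by omega : 0 < #(X \ X'))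
    obtain ⟨j, hj⟩ := Finset.card_pos.1 (by
      rw [Finset.card_sdiff_comm (hX'.trans hX.symm)]; omega : 0 < #(X' \ X))
    rw [Finset.mem_sdiff] at hi hj
    have hiU : i ∉ U := fun hU => hi.2 (by
      have : i ∈ X' ∩ U := by rw [hXU', ← hXU]; exact Finset.mem_inter.2 ⟨hi.1, hU⟩
      exact (Finset.mem_inter.1 this).1)
    have hjU : j ∉ U := fun hU => hj.2 (by
      have : j ∈ X ∩ U := by rw [hXU, ← hXU']; exact Finset.mem_inter.2 ⟨hj.1, hU⟩
      exact (Finset.mem_inter.1 this).1)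
    have hij : i ≠ j := fun h => hj.2 (h ▸ hi.1)
    have hjY : j ∉ X.erase i := fun h => hj.2 (Finset.mem_of_mem_erase h)
    have hc := Finset.card_erase_add_one hi.1
    have hYU : X.erase i ∩ U = V := by
      rw [Finset.erase_inter, Finset.erase_eq_of_notMem (fun h => hiU (Finset.mem_inter.1 h).2),
        hXU]
    have h1 := h (X.erase i) i j (by omega) hYU hiU hjU (Finset.notMem_erase _ _) hjY hij
    rw [Finset.insert_erase hi.1] at h1
    rw [h1]
    refine ih _ (by rw [Finset.card_insert_of_notMem hjY]; omega)
      (by rw [Finset.insert_inter_of_notMem hjU, hYU]) ?_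
    have : insert j (X.erase i) \ X' = (X \ X').erase i := by
      rw [Finset.insert_sdiff_of_mem _ hj.1, Finset.erase_sdiff_comm]
    rw [this, Finset.card_erase_of_mem (Finset.mem_sdiff.2 hi)]
    omega

theorem pairDiff_append_singleton (f : Finset α → ℝ) (L : List (α × α)) (i j : α) (Y : Finset α) :
    pairDiff f (L ++ [(i, j)]) Y = pairDiff (fun Z => f (insert i Z) - f (insert j Z)) L Y := by
  induction L generalizing Y with
  | nil => rfl
  | cons p L ih => simp only [List.cons_append, pairDiff, ih]

theorem IsMatching.append_singleton {L : List (α × α)} (hL : IsMatching L) {i j : α} (hij : i ≠ j)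
    (hi : i ∉ pairSupport L) (hj : j ∉ pairSupport L) : IsMatching (L ++ [(i, j)]) := by
  induction L with
  | nil => simpa [IsMatching, pairSupport] using hij
  | cons p L ih =>
    obtain ⟨h0, h1, h2, h3⟩ := hL
    simp only [pairSupport, Finset.mem_insert, not_or] at hi hj
    have hmem : ∀ x, x ∉ pairSupport L → x ≠ i → x ≠ j → x ∉ pairSupport (L ++ [(i, j)]) := by
      intro x hx hxi hxj hmem
      rw [mem_pairSupport] at hx hmem
      obtain ⟨q, hq, hxq⟩ := hmem
      rcases List.mem_append.1 hq with hq | hq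
      · exact hx ⟨q, hq, hxq⟩
      · rw [List.mem_singleton] at hq
        subst hq
        exact hxq.elim hxi hxj
    exact ⟨h0, hmem _ h1 (Ne.symm hi.1) (Ne.symm hj.1), hmem _ h2 (Ne.symm hi.2.1) (Ne.symm hj.2.1),
      ih h3 hi.2.2 hj.2.2⟩

theorem exists_ne_zero_of_pairDiff_ne_zero {g : Finset α → ℝ} {L : List (α × α)}
    (hL : IsMatching L) {Y : Finset α} (h : pairDiff g L Y ≠ 0) :
    ∃ X ⊆ pairSupport L, #X = L.length ∧ g (X ∪ Y) ≠ 0 := by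
  induction L generalizing Y with
  | nil => exact ⟨∅, by simp, rfl, by simpa [pairDiff] using h⟩
  | cons p L ih =>
    obtain ⟨h0, h1, h2, h3⟩ := hL
    have hsub : pairSupport L ⊆ pairSupport (p :: L) :=
      (Finset.subset_insert _ _).trans (Finset.subset_insert _ _)
    obtain ⟨x, hx, hxL, hne⟩ : ∃ x ∈ pairSupport (p :: L), x ∉ pairSupport L ∧
        pairDiff g L (insert x Y) ≠ 0 := by
      by_contra hcon
      push Not at hcon
      refine h ?_
      simp only [pairDiff]
      rw [hcon p.1 (mem_pairSupport.2 ⟨p, List.mem_cons_self, Or.inl rfl⟩) h1,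
        hcon p.2 (mem_pairSupport.2 ⟨p, List.mem_cons_self, Or.inr rfl⟩) h2, sub_zero]
    obtain ⟨X, hX, hXc, hXg⟩ := ih h3 hne
    refine ⟨insert x X, Finset.insert_subset hx (hX.trans hsub), ?_, ?_⟩
    · rw [Finset.card_insert_of_notMem (fun h => hxL (hX h)), hXc, List.length_cons]
    · rwa [Finset.insert_union, ← Finset.union_insert]

/-- If `f` distinguishes `i` from `j`, then it does so within a bounded set of points, whatever
happens outside of this set. -/
theorem HasPairDegree.exists_certificate {f : Finset α → ℝ} {d : ℕ} (hf : HasPairDegree d f)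
    {i j : α} (hij : i ≠ j) {Y₀ : Finset α} (hi : i ∉ Y₀) (hj : j ∉ Y₀)
    (hne : f (insert i Y₀) ≠ f (insert j Y₀)) :
    ∃ V, i ∈ V ∧ j ∈ V ∧ #V ≤ 2 * d ∧ ∃ t, t + 1 ≤ d ∧ t ≤ #Y₀ ∧
      ∀ Y, Disjoint Y V → #Y + t = #Y₀ → ∃ X ⊆ V, i ∉ X ∧ j ∉ X ∧ #X = t ∧
        f (insert i (X ∪ Y)) ≠ f (insert j (X ∪ Y)) := by
  classical
  set g : Finset α → ℝ := fun Z => f (insert i Z) - f (insert j Z) with hg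
  let p : ℕ → Prop := fun t => ∃ L : List (α × α), IsMatching L ∧ i ∉ pairSupport L ∧
    j ∉ pairSupport L ∧ L.length = t ∧ ∃ Y, Disjoint Y (insert i (insert j (pairSupport L))) ∧
      #Y + t = #Y₀ ∧ pairDiff g L Y ≠ 0
  have hp0 : p 0 := by
    refine ⟨[], trivial, by simp [pairSupport], by simp [pairSupport], rfl, Y₀, ?_, rfl, ?_⟩
    · simp [pairSupport, hi, hj]
    · simpa [pairDiff, hg, sub_eq_zero] using hne
  have hpd : ∀ t, p t → t + 1 ≤ d := by
    rintro t ⟨L, hL, hiL, hjL, rfl, Y, -, -, hY⟩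
    by_contra hlt
    refine hY ?_
    rw [← pairDiff_append_singleton]
    exact hf _ (hL.append_singleton hij hiL hjL) (by simp; omega) Y
  -- A matching along which the difference of `g` survives and which cannot be lengthened. It exists
  -- because adding the pair `(i, j)` gives a nonzero difference of `f` of order `t + 1`, so `t + 1
  -- ≤ d`.
  obtain ⟨t, ht, htmax⟩ : ∃ t, p t ∧ ¬ p (t + 1) := by
    by_contra hcon
    push Not at hcon
    have hall : ∀ t, p t := fun t => by
      induction t with
      | zero => exact hp0
      | succ t ih => exact hcon t ih
    have := hpd d (hall d)
    omega
  obtain ⟨L, hL, hiL, hjL, hLt, Y₁, hY₁, hY₁c, hY₁ne⟩ := ht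
  set V := insert i (insert j (pairSupport L)) with hV
  have hLV : pairSupport L ⊆ V := (Finset.subset_insert _ _).trans (Finset.subset_insert _ _)
  have htd := hpd t ⟨L, hL, hiL, hjL, hLt, Y₁, hY₁, hY₁c, hY₁ne⟩
  refine ⟨V, by simp [hV], by simp [hV], ?_, t, htd, by omega, ?_⟩
  · have h1 := Finset.card_insert_le i (insert j (pairSupport L))
    have h2 := Finset.card_insert_le j (pairSupport L)
    have h3 := card_pairSupport_le L
    rw [hV]
    omega
  intro Y hY hYc
  -- If an exchange of `a` and `b` outside `V` changed this difference, `(a, b) :: L` would be a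
  -- longer matching.
  have hconst : pairDiff g L Y = pairDiff g L Y₁ := by
    refine eq_of_exchange (U := V) (V := ∅) (k := #Y₁) ?_ Y Y₁ (by omega) rfl
      (Finset.disjoint_iff_inter_eq_empty.1 hY) (Finset.disjoint_iff_inter_eq_empty.1 hY₁)
    intro Z a b hZc hZV ha hb haZ hbZ hab
    by_contra hne'
    refine htmax ⟨(a, b) :: L, ⟨hab, fun h => ha (hLV h), fun h => hb (hLV h), hL⟩, ?_, ?_,
      by simp [hLt], Z, ?_, by omega, sub_ne_zero.2 hne'⟩
    · simp only [pairSupport, Finset.mem_insert, not_or]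
      exact ⟨fun h => ha (by simp [hV, h]), fun h => hb (by simp [hV, h]), hiL⟩
    · simp only [pairSupport, Finset.mem_insert, not_or]
      exact ⟨fun h => ha (by simp [hV, h]), fun h => hb (by simp [hV, h]), hjL⟩
    · rw [← Finset.disjoint_iff_inter_eq_empty, hV] at hZV
      simp only [Finset.disjoint_insert_right, pairSupport] at hZV ⊢
      exact ⟨hZV.1, hZV.2.1, haZ, hbZ, hZV.2.2⟩
  obtain ⟨X, hX, hXc, hXg⟩ := exists_ne_zero_of_pairDiff_ne_zero hL (hconst ▸ hY₁ne)
  exact ⟨X, hX.trans hLV, fun h => hiL (hX h), fun h => hjL (hX h), hXc.trans hLt,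
    sub_ne_zero.1 hXg⟩

/-- Greedy choice: the points used so far are too few to make `f` a junta on them, so some exchange
avoiding them changes `f`. -/
theorem exists_matching_of_not_junta {f : Finset α → ℝ} {k N : ℕ}
    (h : ∀ U : Finset α, #U ≤ 2 * N →
      ¬ ∀ X X' : Finset α, #X = k → #X' = k → X ∩ U = X' ∩ U → f X = f X') :
    ∃ L : List (α × α), IsMatching L ∧ L.length = N ∧ ∀ p ∈ L, ∃ Y, #Y + 1 = k ∧
      p.1 ∉ Y ∧ p.2 ∉ Y ∧ p.1 ≠ p.2 ∧ f (insert p.1 Y) ≠ f (insert p.2 Y) := by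
  suffices hs : ∀ t ≤ N, ∃ L : List (α × α), IsMatching L ∧ L.length = t ∧ ∀ p ∈ L, ∃ Y, #Y + 1 = k ∧
      p.1 ∉ Y ∧ p.2 ∉ Y ∧ p.1 ≠ p.2 ∧ f (insert p.1 Y) ≠ f (insert p.2 Y) from hs N le_rfl
  intro t
  induction t with
  | zero => exact fun _ => ⟨[], trivial, rfl, by simp⟩
  | succ t ih =>
    intro ht
    obtain ⟨L, hL, hLt, hLp⟩ := ih (by omega)
    have hcard := card_pairSupport_le L
    have h1 := h (pairSupport L) (by omega)
    obtain ⟨Y, i, j, hYc, hiL, hjL, hiY, hjY, hij, hne⟩ : ∃ Y i j, #Y + 1 = k ∧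
        i ∉ pairSupport L ∧ j ∉ pairSupport L ∧ i ∉ Y ∧ j ∉ Y ∧ i ≠ j ∧
        f (insert i Y) ≠ f (insert j Y) := by
      by_contra hcon
      push Not at hcon
      refine h1 fun X X' hX hX' hXX => eq_of_exchange (U := pairSupport L) (V := X ∩ pairSupport L)
        ?_ X X' hX hX' rfl hXX.symm
      exact fun Y i j hc _ hi hj hiY hjY hij => hcon Y i j hc hi hj hiY hjY hij
    refine ⟨(i, j) :: L, ⟨hij, hiL, hjL, hL⟩, by simp [hLt], ?_⟩
    intro p hp
    rcases List.mem_cons.1 hp with rfl | hp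
    · exact ⟨Y, hYc, hiY, hjY, hij, hne⟩
    · exact hLp p hp

end PairDiff

/-! ### Möbius coefficients of a restriction to few points -/

section Moebius

variable {α : Type} [DecidableEq α]

/-- The coefficient of `∏ i ∈ S, x i` in the multilinear polynomial representing `F`. -/
def moebius (F : Finset α → ℝ) (S : Finset α) : ℝ :=
  ∑ T ∈ S.powerset, (-1) ^ (#S + #T) * F T

theorem moebius_insert (F : Finset α → ℝ) {a : α} {S : Finset α} (ha : a ∉ S) :
    moebius F (insert a S) = moebius (fun T => F (insert a T)) S - moebius F S := by
  unfold moebius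
  rw [Finset.sum_powerset_insert ha, add_comm, sub_eq_add_neg, ← Finset.sum_neg_distrib]
  congr 1
  · refine Finset.sum_congr rfl fun T hT => ?_
    rw [Finset.card_insert_of_notMem ha,
      Finset.card_insert_of_notMem (fun h => ha (Finset.mem_powerset.1 hT h))]
    ring
  · refine Finset.sum_congr rfl fun T hT => ?_
    rw [Finset.card_insert_of_notMem ha]
    ring

theorem sum_moebius (F : Finset α → ℝ) (X : Finset α) : ∑ S ∈ X.powerset, moebius F S = F X := by
  induction X using Finset.induction_on generalizing F with
  | empty => simp [moebius]
  | insert a X ha ih =>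
    rw [Finset.sum_powerset_insert ha]
    have : ∀ S ∈ X.powerset, moebius F (insert a S) =
        moebius (fun T => F (insert a T)) S - moebius F S := fun S hS =>
      moebius_insert F (fun h => ha (Finset.mem_powerset.1 hS h))
    rw [Finset.sum_congr rfl this, Finset.sum_sub_distrib, ih, ih]
    ring

/-- Since points of `D` are interchangeable, replacing a point of `U` by one of `D` amounts to
deleting it from `T`. A pair difference thus becomes an ordinary finite difference of `F`. -/
theorem pairDiff_eq_moebius {f F : Finset α → ℝ} {U D E : Finset α} {K : ℕ}
    (hF : ∀ T ⊆ U, ∀ Z ⊆ D, #T + #Z = K → f (T ∪ Z ∪ E) = F T) {L : List (α × α)}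
    (hL : IsMatching L) {T Z : Finset α} (hT : T ⊆ U) (hZ : Z ⊆ D)
    (hLT : ∀ p ∈ L, p.1 ∈ U ∧ p.1 ∉ T ∧ p.2 ∈ D ∧ p.2 ∉ Z) (hc : #T + #Z + L.length = K) :
    pairDiff f L (T ∪ Z ∪ E) = moebius (fun V => F (V ∪ T)) (L.map Prod.fst).toFinset := by
  induction L generalizing T Z with
  | nil =>
    simp only [pairDiff, moebius]
    simpa using hF T hT Z hZ hc
  | cons p L ih =>
    obtain ⟨h0, h1, h2, h3⟩ := hL
    obtain ⟨hp1, hp2, hp3, hp4⟩ := hLT p List.mem_cons_self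
    have hLT' := fun q (hq : q ∈ L) => hLT q (List.mem_cons_of_mem _ hq)
    rw [List.length_cons] at hc
    simp only [pairDiff, List.map_cons, List.toFinset_cons]
    rw [moebius_insert]
    · have e1 : insert p.1 (T ∪ Z ∪ E) = insert p.1 T ∪ Z ∪ E := by
        rw [Finset.insert_union, Finset.insert_union]
      have e2 : insert p.2 (T ∪ Z ∪ E) = T ∪ insert p.2 Z ∪ E := by
        rw [Finset.union_insert, Finset.insert_union]
      rw [e1, e2, ih h3 (Finset.insert_subset hp1 hT) hZ, ih h3 hT (Finset.insert_subset hp3 hZ)]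
      · simp only [Finset.union_insert, Finset.insert_union]
      · refine fun q hq => ⟨(hLT' q hq).1, (hLT' q hq).2.1, (hLT' q hq).2.2.1, ?_⟩
        rw [Finset.mem_insert, not_or]
        refine ⟨fun h => h2 (mem_pairSupport.2 ⟨q, hq, Or.inr h.symm⟩), (hLT' q hq).2.2.2⟩
      · rw [Finset.card_insert_of_notMem hp4]; omega
      · refine fun q hq => ⟨(hLT' q hq).1, ?_, (hLT' q hq).2.2⟩
        rw [Finset.mem_insert, not_or]
        refine ⟨fun h => h1 (mem_pairSupport.2 ⟨q, hq, Or.inl h.symm⟩), (hLT' q hq).2.1⟩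
      · rw [Finset.card_insert_of_notMem hp2]; omega
    · intro h
      obtain ⟨q, hq, hqp⟩ := List.mem_map.1 (List.mem_toFinset.1 h)
      exact h1 (mem_pairSupport.2 ⟨q, hq, Or.inl hqp.symm⟩)

theorem exists_matching_between (S Z : Finset α) (hd : Disjoint S Z) (hc : #S = #Z) :
    ∃ L : List (α × α), IsMatching L ∧ L.length = #S ∧ (L.map Prod.fst).toFinset = S ∧
      ∀ p ∈ L, p.1 ∈ S ∧ p.2 ∈ Z := by
  induction S using Finset.induction_on generalizing Z with
  | empty => exact ⟨[], trivial, rfl, rfl, by simp⟩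
  | insert a S ha ih =>
    rw [Finset.card_insert_of_notMem ha] at hc ⊢
    rw [Finset.disjoint_insert_left] at hd
    obtain ⟨z, hz⟩ := Finset.card_pos.1 (by omega : 0 < #Z)
    obtain ⟨L, hL, hLc, hLS, hLp⟩ := ih (Z.erase z) (hd.2.mono_right (Finset.erase_subset _ _))
      (by rw [Finset.card_erase_of_mem hz]; omega)
    refine ⟨(a, z) :: L, ⟨fun h => hd.1 (by simp only at h; exact h ▸ hz), ?_, ?_, hL⟩,
      by simp [hLc], by simp [hLS], ?_⟩
    · intro h
      obtain ⟨p, hp, h | h⟩ := mem_pairSupport.1 h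
      · exact ha (by simp only at h; exact h ▸ (hLp p hp).1)
      · exact hd.1 (by simp only at h; exact h ▸ Finset.mem_of_mem_erase (hLp p hp).2)
    · intro h
      obtain ⟨p, hp, h | h⟩ := mem_pairSupport.1 h
      · exact Finset.disjoint_left.1 hd.2 (hLp p hp).1 (by simp only at h; exact h ▸ hz)
      · exact Finset.ne_of_mem_erase (hLp p hp).2 h.symm
    · intro p hp
      rcases List.mem_cons.1 hp with rfl | hp
      · exact ⟨Finset.mem_insert_self _ _, hz⟩
      · exact ⟨Finset.mem_insert_of_mem (hLp p hp).1, Finset.mem_of_mem_erase (hLp p hp).2⟩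

/-- The coefficients of a restriction of `f` to a set `U`, the remaining weight being put on
interchangeable points. -/
theorem exists_expansion {A : Finset ℝ} {d K : ℕ} {f F : Finset α → ℝ}
    (hf : HasPairDegree d f) {U D E : Finset α} (hUD : Disjoint U D) (hD : 2 * K ≤ #D)
    (hF : ∀ T ⊆ U, ∀ Z ⊆ D, #T + #Z = K → f (T ∪ Z ∪ E) = F T)
    (hFA : ∀ T ⊆ U, #T ≤ K → F T ∈ A) :
    ∃ c : Finset α → ℝ, IsExpansion A d K c ∧
      ∀ X ⊆ U, #X ≤ K → ∑ S ∈ X.powerset, c S = F X := by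
  -- Pair `S` with a set `Z₀ ⊆ D` of equal size and fill up to weight `K` with `Z₁ ⊆ D \ Z₀`; the
  -- room comes from `2 * K ≤ #D`. The degree condition kills this difference.
  have hzero : ∀ S ⊆ U, d < #S → #S ≤ K → moebius F S = 0 := by
    intro S hSU hdS hSK
    obtain ⟨Z₀, hZ₀, hZ₀c⟩ := Finset.exists_subset_card_eq (show #S ≤ #D by omega)
    obtain ⟨Z₁, hZ₁, hZ₁c⟩ := Finset.exists_subset_card_eq (show K - #S ≤ #(D \ Z₀) by
      rw [Finset.card_sdiff_of_subset hZ₀]; omega)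
    obtain ⟨L, hL, hLc, hLS, hLp⟩ := exists_matching_between S Z₀ (hUD.mono hSU hZ₀) hZ₀c.symm
    have := pairDiff_eq_moebius hF hL (Finset.empty_subset U) (hZ₁.trans sdiff_subset)
      (fun p hp => ⟨hSU (hLp p hp).1, by simp, hZ₀ (hLp p hp).2,
        fun h => (Finset.mem_sdiff.1 (hZ₁ h)).2 (hLp p hp).2⟩) (by rw [Finset.card_empty]; omega)
    rw [hf L hL (by omega), hLS] at this
    simpa using this.symm
  -- Truncation to subsets of `U` of size at most `d` represents `X ↦ F (X ∩ U)` on all `X` of size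
  -- at most `K`.
  set c : Finset α → ℝ := fun S => if S ⊆ U ∧ #S ≤ d then moebius F S else 0 with hc
  have hsum : ∀ X, #X ≤ K → ∑ S ∈ X.powerset, c S = F (X ∩ U) := by
    intro X hX
    rw [← sum_moebius F (X ∩ U)]
    symm
    trans ∑ S ∈ (X ∩ U).powerset, c S
    · refine Finset.sum_congr rfl fun S hS => ?_
      have hS' := Finset.mem_powerset.1 hS
      have hSU : S ⊆ U := hS'.trans inter_subset_right
      have hSX := Finset.card_le_card (hS'.trans inter_subset_left)
      by_cases hSd : #S ≤ d
      · simp [hc, hSU, hSd]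
      · simp only [hc, hSd, and_false, if_false]
        exact hzero S hSU (by omega) (by omega)
    · refine Finset.sum_subset (Finset.powerset_mono.2 inter_subset_left) fun S hS hS' => ?_
      rw [Finset.mem_powerset] at hS hS'
      simp only [hc]
      rw [if_neg]
      exact fun h => hS' (Finset.subset_inter hS h.1)
  refine ⟨c, ⟨fun S hS => ?_, fun X hX => ?_⟩, fun X hXU hX => ?_⟩
  · simp only [hc]
    rw [if_neg]
    omega
  · rw [hsum X hX]
    exact hFA _ inter_subset_right ((Finset.card_le_card inter_subset_left).trans hX)
  · rw [hsum X hX, Finset.inter_eq_left.2 hXU]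

end Moebius

/-! ### From a function that is not a junta to an expansion with many variables -/

theorem exists_expansion_of_not_junta (A : Finset ℝ) {d K : ℕ} (hdK : d ≤ K) (N : ℕ) :
    ∃ M, ∀ {n k : ℕ}, K ≤ k → 2 * k ≤ n → M ≤ n → ∀ f : Finset (Fin n) → ℝ, HasPairDegree d f →
      (∀ X, #X = k → f X ∈ A) →
      (∀ U : Finset (Fin n), #U ≤ 2 * N →
        ¬ ∀ X X' : Finset (Fin n), #X = k → #X' = k → X ∩ U = X' ∩ U → f X = f X') →
      ∃ c : Finset (Fin n) → ℝ, IsExpansion A d K c ∧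
        ∃ L : List (Fin n × Fin n), IsMatching L ∧ L.length = N ∧
          ∀ p ∈ L, (∃ S, p.1 ∈ S ∧ c S ≠ 0) ∨ (∃ S, p.2 ∈ S ∧ c S ≠ 0) := by
  obtain ⟨ρ, hρ⟩ := exists_homogeneous ((#A + 1) ^ 2 ^ (N * (2 * d))) (K + 1) (2 * K)
  -- `U` and `D₀` together occupy at most half of the coordinates, and `n ≥ 2 * k` leaves `k - K`
  -- others for the padding `E`.
  refine ⟨2 * (N * (2 * d) + ρ), fun {n k} hKk hkn hn f hf hfA hjunta => ?_⟩
  obtain ⟨L, hL, hLN, hLp⟩ := exists_matching_of_not_junta hjunta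
  have hcert : ∀ p ∈ L, ∃ V : Finset (Fin n), p.1 ∈ V ∧ p.2 ∈ V ∧ #V ≤ 2 * d ∧ ∃ t, t + 1 ≤ d ∧
      ∀ Y, Disjoint Y V → #Y + t + 1 = k → ∃ X ⊆ V, p.1 ∉ X ∧ p.2 ∉ X ∧ #X = t ∧
        f (insert p.1 (X ∪ Y)) ≠ f (insert p.2 (X ∪ Y)) := by
    intro p hp
    obtain ⟨Y₀, hY₀, h1, h2, h3, h4⟩ := hLp p hp
    obtain ⟨V, hV1, hV2, hVc, t, htd, -, ht⟩ := hf.exists_certificate h3 h1 h2 h4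
    exact ⟨V, hV1, hV2, hVc, t, htd, fun Y hY hYc => ht Y hY (by omega)⟩
  choose! V hV1 hV2 hVc t htd hVt using hcert
  set U := L.toFinset.biUnion V with hU
  have hVU : ∀ p ∈ L, V p ⊆ U := fun p hp =>
    Finset.subset_biUnion_of_mem V (List.mem_toFinset.2 hp)
  have hUc : #U ≤ N * (2 * d) :=
    (Finset.card_biUnion_le_card_mul _ _ (2 * d) fun p hp => hVc p (List.mem_toFinset.1 hp)).trans
      (Nat.mul_le_mul_right _ ((List.toFinset_card_le L).trans hLN.le))
  obtain ⟨D₀, hD₀, hD₀c⟩ := Finset.exists_subset_card_eq (show ρ ≤ #(Uᶜ) by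
    rw [Finset.card_compl, Fintype.card_fin]; omega)
  obtain ⟨E, hE, hEc⟩ := Finset.exists_subset_card_eq (show k - K ≤ #((U ∪ D₀)ᶜ) by
    have := Finset.card_union_le U D₀
    rw [Finset.card_compl, Fintype.card_fin]; omega)
  obtain ⟨D, hD, hDc, hcol⟩ := hρ (κ := U.powerset → Option A) D₀ hD₀c.ge (by
      rw [Fintype.card_fun, Fintype.card_option, Fintype.card_coe, Fintype.card_coe,
        Finset.card_powerset]
      exact Nat.pow_le_pow_right (by omega) (Nat.pow_le_pow_right (by omega) hUc))
    -- The colour of `Z` lists the values of `f` for all `T ⊆ U`. The value is guaranteed to lie in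
    -- `A` only at total weight `k`, hence the default `none`.
    (fun Z T => if h : f (T ∪ Z ∪ E) ∈ A then some ⟨_, h⟩ else none)
  have hUD : Disjoint U D := by
    rw [disjoint_comm]
    exact Finset.disjoint_left.2 fun x hx => Finset.mem_compl.1 (hD₀ (hD hx))
  have hcard : ∀ T ⊆ U, ∀ Z ⊆ D, #T + #Z = K → #(T ∪ Z ∪ E) = k := by
    intro T hT Z hZ hTZ
    rw [Finset.card_union_of_disjoint, Finset.card_union_of_disjoint (hUD.mono hT hZ)]
    · omega
    · rw [disjoint_comm]
      refine Finset.disjoint_left.2 fun x hx hx' => Finset.mem_compl.1 (hE hx) ?_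
      exact Finset.union_subset_union hT (hZ.trans hD) hx'
  have hch : ∀ j, ∃ Z, j ≤ K → Z ⊆ D ∧ #Z = j := fun j => by
    by_cases hj : j ≤ K
    · obtain ⟨Z, hZ⟩ := Finset.exists_subset_card_eq (show j ≤ #D by omega)
      exact ⟨Z, fun _ => hZ⟩
    · exact ⟨∅, fun h => absurd h hj⟩
  choose Zf hZf using hch
  set F : Finset (Fin n) → ℝ := fun T => f (T ∪ Zf (K - #T) ∪ E) with hFdef
  have hF : ∀ T ⊆ U, ∀ Z ⊆ D, #T + #Z = K → f (T ∪ Z ∪ E) = F T := by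
    intro T hT Z hZ hTZ
    obtain ⟨h1, h2⟩ := hZf (K - #T) (by omega)
    have h3 := congrFun (hcol Z hZ _ h1 (by omega) (by omega)) ⟨T, Finset.mem_powerset.2 hT⟩
    have h4 := hfA _ (hcard T hT Z hZ hTZ)
    have h5 := hfA _ (hcard T hT _ h1 (by omega))
    dsimp only at h3
    rw [dif_pos h4, dif_pos h5] at h3
    exact congrArg Subtype.val (Option.some.inj h3)
  have hFA : ∀ T ⊆ U, #T ≤ K → F T ∈ A := by
    intro T hT hTK
    obtain ⟨h1, h2⟩ := hZf (K - #T) (by omega)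
    exact hfA _ (hcard T hT _ h1 (by omega))
  obtain ⟨c, hc, hcF⟩ := exists_expansion hf hUD hDc hF hFA
  refine ⟨c, hc, L, hL, hLN, fun p hp => ?_⟩
  by_contra hcon
  push Not at hcon
  have htd' := htd p hp
  obtain ⟨hZ, hZc⟩ := hZf (K - (t p + 1)) (by omega)
  obtain ⟨X, hX, hX1, hX2, hXc, hne⟩ := hVt p hp (Zf (K - (t p + 1)) ∪ E) (by
      rw [disjoint_comm]
      refine Finset.disjoint_left.2 fun x hx hx' => ?_
      rcases Finset.mem_union.1 hx' with h | h
      · exact Finset.disjoint_left.1 hUD (hVU p hp hx) (hZ h)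
      · exact Finset.mem_compl.1 (hE h) (Finset.mem_union_left _ (hVU p hp hx))) (by
      have := hcard ∅ (Finset.empty_subset _)
      rw [Finset.card_union_of_disjoint]
      · omega
      · rw [disjoint_comm]
        refine Finset.disjoint_left.2 fun x hx hx' => Finset.mem_compl.1 (hE hx) ?_
        exact Finset.mem_union_right _ (hD (hZ hx')))
  -- If `i` occurs in no monomial, inserting it does not change the expansion. If neither point of
  -- `p` occurred, the certificate's two values would agree.
  have hval : ∀ i, i ∈ V p → i ∉ X → (∀ S, i ∈ S → c S = 0) →
      f (insert i (X ∪ (Zf (K - (t p + 1)) ∪ E))) = ∑ S ∈ X.powerset, c S := by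
    intro i hiV hiX hi
    have hiXU : insert i X ⊆ U := (Finset.insert_subset hiV hX).trans (hVU p hp)
    have hiXc : #(insert i X) = t p + 1 := by rw [Finset.card_insert_of_notMem hiX, hXc]
    rw [← Finset.union_assoc, ← Finset.insert_union, ← Finset.insert_union,
      hF _ hiXU _ hZ (by omega), ← hcF _ hiXU (by omega), Finset.sum_powerset_insert hiX,
      Finset.sum_eq_zero (s := X.powerset) (f := fun S => c (insert i S)), add_zero]
    exact fun S _ => hi _ (Finset.mem_insert_self _ _)
  exact hne ((hval p.1 (hV1 p hp) hX1 hcon.1).trans (hval p.2 (hV2 p hp) hX2 hcon.2).symm)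

/-! ### Points of the slice as sets, and the junta theorem -/

theorem isJuntaOn_iff {n k : ℕ} {J : Finset (Fin n)} {f : Slice n k → ℝ} :
    IsJuntaOn J f ↔ ∀ x y : Slice n k, (∀ j ∈ J, x.1 j = y.1 j) → f x = f y := by
  constructor
  · rintro ⟨g, hg⟩ x y hxy
    rw [hg, hg]
    congr 1
    funext j
    exact hxy j j.2
  · intro h
    have hg : ∀ z : J → Fin 2, ∃ v, ∀ x : Slice n k, (fun j : J => x.1 j) = z → f x = v := by
      intro z
      by_cases hz : ∃ x : Slice n k, (fun j : J => x.1 j) = z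
      · obtain ⟨y, hy⟩ := hz
        exact ⟨f y, fun x hx => h x y fun j hj => congrFun (hx.trans hy.symm) ⟨j, hj⟩⟩
      · exact ⟨0, fun x hx => absurd ⟨x, hx⟩ hz⟩
    choose g hg using hg
    exact ⟨g, fun x => hg _ x rfl⟩

/-- The set of coordinates at which a point of the slice is one. -/
def Slice.ones {n k : ℕ} (x : Slice n k) : Finset (Fin n) := univ.filter (fun i => x.1 i = 1)

theorem fin_two_val_eq (a : Fin 2) : (a : ℕ) = if a = 1 then 1 else 0 := by
  fin_cases a <;> rfl

theorem Slice.val_eq {n k : ℕ} (x : Slice n k) (i : Fin n) :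
    ((x.1 i : ℕ)) = if i ∈ x.ones then 1 else 0 := by
  rw [fin_two_val_eq]
  simp [Slice.ones]

theorem Slice.card_ones {n k : ℕ} (x : Slice n k) : #x.ones = k := by
  have h := x.2
  rw [Finset.sum_congr rfl fun i _ => x.val_eq i] at h
  simpa using h

/-- The point of the slice with prescribed set of ones. -/
def Slice.ofOnes {n k : ℕ} (X : Finset (Fin n)) (hX : #X = k) : Slice n k :=
  ⟨fun i => if i ∈ X then 1 else 0, by
    rw [← hX, Finset.card_eq_sum_ones, ← Finset.sum_filter_add_sum_filter_not univ (· ∈ X)]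
    rw [Finset.sum_congr rfl (g := fun _ => 1), Finset.sum_eq_zero (s := univ.filter (· ∉ X))]
    · simp
    · intro i hi
      simp [(Finset.mem_filter.1 hi).2]
    · intro i hi
      simp [(Finset.mem_filter.1 hi).2]⟩

theorem Slice.ones_ofOnes {n k : ℕ} (X : Finset (Fin n)) (hX : #X = k) :
    (Slice.ofOnes X hX).ones = X := by
  ext i
  simp [Slice.ones, Slice.ofOnes]

theorem exists_isJunta_bound (A : Finset ℝ) (d : ℕ) :
    ∃ M : ℕ, ∀ k : ℕ, threshold A d ≤ k → ∀ n : ℕ, 2 * k ≤ n →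
      ∀ f : Slice n k → ℝ, IsValuedIn A f → HasDegree d f → IsJunta M f := by
  obtain ⟨G, hG⟩ := exists_card_vars_bound (le_refl (threshold A d))
  obtain ⟨M, hM⟩ := exists_expansion_of_not_junta A (Nat.le_add_right d _ : d ≤ threshold A d) (G + 1)
  refine ⟨M + 2 * (G + 1), fun k hk n hn f hfA hfd => ?_⟩
  by_cases hnM : n < M
  · refine ⟨univ, by rw [Finset.card_univ, Fintype.card_fin]; omega, isJuntaOn_iff.2 ?_⟩
    intro x y hxy
    rw [show x = y from Subtype.ext (funext fun i => hxy i (Finset.mem_univ _))]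
  by_contra hjunta
  obtain ⟨P, hPd, hP⟩ := hfd
  set F : Finset (Fin n) → ℝ :=
    fun X => MvPolynomial.eval (fun i => if i ∈ X then (1 : ℝ) else 0) P with hF
  have hfF : ∀ x : Slice n k, f x = F x.ones := by
    intro x
    rw [hP, hF]
    dsimp only
    congr 2
    funext i
    rw [x.val_eq]
    push_cast
    rfl
  obtain ⟨c, hc, L, hL, hLc, hLp⟩ := hM hk hn (not_lt.1 hnM) F (hasPairDegree_eval P hPd)
    (fun X hX => by
      rw [← Slice.ones_ofOnes X hX, ← hfF]
      exact hfA _)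
    (fun U hU h => hjunta ⟨U, by omega, isJuntaOn_iff.2 fun x y hxy => by
      rw [hfF, hfF]
      refine h _ _ x.card_ones y.card_ones ?_
      ext i
      simp only [Finset.mem_inter, Slice.ones, Finset.mem_filter, Finset.mem_univ, true_and]
      constructor
      · exact fun hi => ⟨hxy i hi.2 ▸ hi.1, hi.2⟩
      · exact fun hi => ⟨(hxy i hi.2).symm ▸ hi.1, hi.2⟩⟩)
  classical
  -- Each of the `G + 1` disjoint pairs contributes its own occurring variable, one more than `G`
  -- allows.
  have h1 := hL.length_le (S := (pairSupport L).filter (fun v => ∃ S, v ∈ S ∧ c S ≠ 0)) fun p hp => by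
    simp only [Finset.mem_filter]
    refine (hLp p hp).imp (fun h => ⟨mem_pairSupport.2 ⟨p, hp, Or.inl rfl⟩, h⟩)
      (fun h => ⟨mem_pairSupport.2 ⟨p, hp, Or.inr rfl⟩, h⟩)
  have h2 := hG c hc ((pairSupport L).filter (fun v => ∃ S, v ∈ S ∧ c S ≠ 0))
    fun v hv => (Finset.mem_filter.1 hv).2
  have h3 := Finset.card_le_card (Finset.inter_subset_left
    (s₁ := (pairSupport L).filter (fun v => ∃ S, v ∈ S ∧ c S ≠ 0)) (s₂ := pairSupport L))
  omega

/-! ### Functions below the threshold that are not juntas -/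

theorem exists_disjoint_blocks {α : Type} [DecidableEq α] (N e : ℕ) (he : 1 ≤ e) (V : Finset α)
    (hV : N * e ≤ #V) : ∃ 𝓑 : Finset (Finset α), #𝓑 = N ∧ (∀ B ∈ 𝓑, #B = e ∧ B ⊆ V) ∧
      (𝓑 : Set (Finset α)).PairwiseDisjoint id := by
  induction N generalizing V with
  | zero => exact ⟨∅, by simp⟩
  | succ N ih =>
    rw [Nat.succ_mul] at hV
    obtain ⟨B, hB, hBc⟩ := Finset.exists_subset_card_eq (show e ≤ #V by omega)
    obtain ⟨𝓑, h1, h2, h3⟩ := ih (V \ B) (by rw [Finset.card_sdiff_of_subset hB]; omega)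
    have hdisj : ∀ C ∈ 𝓑, Disjoint B C := fun C hC =>
      Finset.disjoint_sdiff.mono_right (h2 C hC).2
    have hB𝓑 : B ∉ 𝓑 := fun h => by
      have := (Finset.disjoint_self_iff_empty B).1 (hdisj B h)
      rw [this, Finset.card_empty] at hBc
      omega
    refine ⟨insert B 𝓑, by rw [Finset.card_insert_of_notMem hB𝓑, h1], ?_, ?_⟩
    · intro C hC
      rcases Finset.mem_insert.1 hC with rfl | hC
      · exact ⟨hBc, hB⟩
      · exact ⟨(h2 C hC).1, (h2 C hC).2.trans sdiff_subset⟩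
    · rw [Finset.coe_insert]
      exact h3.insert fun C hC _ => hdisj C hC

theorem totalDegree_prod_X_le {α : Type} (B : Finset α) :
    (∏ i ∈ B, (MvPolynomial.X i : MvPolynomial α ℝ)).totalDegree ≤ #B := by
  refine (MvPolynomial.totalDegree_finsetProd _ _).trans ?_
  simp

section BlockPolynomial

variable {α : Type}

/-- The polynomial which, on the indicator of `X`, is `P` evaluated at the number of blocks
contained in `X` if `Q ⊆ X`, and `P(0)` otherwise. -/
noncomputable def blockPolynomial (P : Polynomial ℝ) (Q : Finset α) (𝓑 : Finset (Finset α)) :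
    MvPolynomial α ℝ :=
  MvPolynomial.C (P.eval 0) + (∏ i ∈ Q, MvPolynomial.X i) *
    (Polynomial.aeval (∑ B ∈ 𝓑, ∏ i ∈ B, (MvPolynomial.X i : MvPolynomial α ℝ)) P -
      MvPolynomial.C (P.eval 0))

theorem totalDegree_blockPolynomial_le (P : Polynomial ℝ) (Q : Finset α) {𝓑 : Finset (Finset α)}
    {e : ℕ} (h𝓑 : ∀ B ∈ 𝓑, #B = e) :
    (blockPolynomial P Q 𝓑).totalDegree ≤ #Q + P.natDegree * e := by
  have hS : (∑ B ∈ 𝓑, ∏ i ∈ B, (MvPolynomial.X i : MvPolynomial α ℝ)).totalDegree ≤ e :=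
    MvPolynomial.totalDegree_finsetSum_le fun B hB => (totalDegree_prod_X_le B).trans (h𝓑 B hB).le
  have hP : (Polynomial.aeval (∑ B ∈ 𝓑, ∏ i ∈ B, (MvPolynomial.X i : MvPolynomial α ℝ))
      P).totalDegree ≤ P.natDegree * e := by
    rw [Polynomial.aeval_eq_sum_range]
    refine MvPolynomial.totalDegree_finsetSum_le fun j hj => ?_
    refine (MvPolynomial.totalDegree_smul_le _ _).trans ((MvPolynomial.totalDegree_pow _ _).trans ?_)
    exact Nat.mul_le_mul (by have := Finset.mem_range.1 hj; omega) hS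
  refine (MvPolynomial.totalDegree_add _ _).trans (max_le ?_ ?_)
  · simp
  · refine (MvPolynomial.totalDegree_mul _ _).trans (Nat.add_le_add (totalDegree_prod_X_le Q) ?_)
    refine (MvPolynomial.totalDegree_sub _ _).trans (max_le hP ?_)
    simp

theorem prod_indicator [DecidableEq α] (B X : Finset α) :
    ∏ i ∈ B, (if i ∈ X then (1 : ℝ) else 0) = if B ⊆ X then 1 else 0 := by
  split_ifs with h
  · exact Finset.prod_eq_one fun i hi => by simp [h hi]
  · obtain ⟨i, hi, hiX⟩ := Finset.not_subset.1 h
    exact Finset.prod_eq_zero hi (by simp [hiX])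

theorem eval_blockPolynomial [DecidableEq α] (P : Polynomial ℝ) (Q : Finset α) (𝓑 : Finset (Finset α))
    (X : Finset α) :
    MvPolynomial.eval (fun i => if i ∈ X then (1 : ℝ) else 0) (blockPolynomial P Q 𝓑) =
      if Q ⊆ X then P.eval (#{B ∈ 𝓑 | B ⊆ X} : ℝ) else P.eval 0 := by
  have h1 : MvPolynomial.eval (fun i => if i ∈ X then (1 : ℝ) else 0)
      (Polynomial.aeval (∑ B ∈ 𝓑, ∏ i ∈ B, (MvPolynomial.X i : MvPolynomial α ℝ)) P) =
      P.eval (#{B ∈ 𝓑 | B ⊆ X} : ℝ) := by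
    rw [← MvPolynomial.coe_aeval_eq_eval, RingHom.coe_coe, ← Polynomial.aeval_algHom_apply]
    simp only [map_sum, map_prod, MvPolynomial.aeval_X, prod_indicator, Finset.sum_boole]
    rw [Polynomial.coe_aeval_eq_eval]
  simp only [blockPolynomial, map_add, map_mul, map_sub, map_prod, MvPolynomial.eval_C,
    MvPolynomial.eval_X, prod_indicator, h1]
  split_ifs <;> ring

end BlockPolynomial

theorem exists_not_isJunta_of_polynomial {A : Finset ℝ} {d k r e t : ℕ} (he : 1 ≤ e)
    {P : Polynomial ℝ} (hPA : ∀ i : ℕ, i ≤ t → P.eval (i : ℝ) ∈ A)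
    (hP : ∃ i < t, P.eval (i : ℝ) ≠ P.eval ((i + 1 : ℕ) : ℝ)) (hd : r + P.natDegree * e ≤ d)
    (hk : r + t * e ≤ k) (hk' : k < r + (t + 1) * e) (m : ℕ) :
    ∃ n : ℕ, 2 * k ≤ n ∧ ∃ f : Slice n k → ℝ, IsValuedIn A f ∧ HasDegree d f ∧ ¬ IsJunta m f := by
  -- A set `J` of at most `m` coordinates meets at most `m` filler points and `m` blocks, so `k`
  -- filler points and `t` blocks always remain free.
  set n := r + (k + m) + (m + t) * e + 2 * k with hn
  obtain ⟨Q, -, hQc⟩ := Finset.exists_subset_card_eq (show r ≤ #(univ : Finset (Fin n)) by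
    rw [Finset.card_univ, Fintype.card_fin]; omega)
  obtain ⟨D, hD, hDc⟩ := Finset.exists_subset_card_eq (show k + m ≤ #Qᶜ by
    rw [Finset.card_compl, Fintype.card_fin]; omega)
  have hQD : Disjoint Q D := by
    rw [disjoint_comm]
    exact Finset.disjoint_left.2 fun x hx => Finset.mem_compl.1 (hD hx)
  obtain ⟨𝓑, h𝓑c, h𝓑, h𝓑d⟩ := exists_disjoint_blocks (m + t) e he (Q ∪ D)ᶜ (by
    rw [Finset.card_compl, Fintype.card_fin, Finset.card_union_of_disjoint hQD]; omega)
  have hBe : ∀ B ∈ 𝓑, #(id B) = e := fun B hB => (h𝓑 B hB).1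
  have hQDB : ∀ B ∈ 𝓑, Disjoint (Q ∪ D) (id B) := fun B hB => by
    rw [disjoint_comm]
    exact Finset.disjoint_left.2 fun x hx => Finset.mem_compl.1 ((h𝓑 B hB).2 hx)
  set F : Finset (Fin n) → ℝ := fun X =>
    if Q ⊆ X then P.eval (#{B ∈ 𝓑 | B ⊆ X} : ℝ) else P.eval 0 with hF
  refine ⟨n, by omega, fun x => F x.ones, ?_, ?_, ?_⟩
  · intro x
    simp only [hF]
    split_ifs with hQ
    · refine hPA _ ?_
      set 𝓒 := {B ∈ 𝓑 | B ⊆ x.ones} with h𝓒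
      have h1 : Q ∪ 𝓒.biUnion id ⊆ x.ones :=
        Finset.union_subset hQ (Finset.biUnion_subset.2 fun B hB => (Finset.mem_filter.1 hB).2)
      have h2 := Finset.card_le_card h1
      rw [card_union_biUnion_blocks (B := id) hBe h𝓑d hQDB subset_union_left
        (show 𝓒 ⊆ 𝓑 from Finset.filter_subset _ _), x.card_ones, hQc] at h2
      have h3 : #𝓒 * e < (t + 1) * e := by omega
      have := Nat.lt_of_mul_lt_mul_right h3
      omega
    · simpa using hPA 0 (Nat.zero_le _)
  · refine ⟨blockPolynomial P Q 𝓑, ?_, fun x => ?_⟩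
    · refine (totalDegree_blockPolynomial_le P Q hBe).trans ?_
      rwa [hQc]
    · refine (eval_blockPolynomial P Q 𝓑 x.ones).symm.trans ?_
      congr 2
      funext i
      rw [x.val_eq]
      push_cast
      rfl
  · rintro ⟨J, hJ, hfJ⟩
    rw [isJuntaOn_iff] at hfJ
    obtain ⟨i, hit, hi⟩ := hP
    have hQZ : ∀ Z ⊆ D, Q ∪ Z ⊆ Q ∪ D := fun Z hZ => Finset.union_subset_union subset_rfl hZ
    have hFval : ∀ 𝓒 ⊆ 𝓑, ∀ Z ⊆ D, F (Q ∪ Z ∪ 𝓒.biUnion id) = P.eval (#𝓒 : ℝ) := by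
      intro 𝓒 h𝓒 Z hZ
      have h1 : {B ∈ 𝓑 | B ⊆ Q ∪ Z ∪ 𝓒.biUnion id} = 𝓒 := by
        ext B
        rw [Finset.mem_filter]
        constructor
        · rintro ⟨hB, hsub⟩
          exact (block_subset_union_biUnion_iff (B := id) he hBe h𝓑d hQDB (hQZ Z hZ) h𝓒 hB).1 hsub
        · exact fun hB => ⟨h𝓒 hB,
            (block_subset_union_biUnion_iff (B := id) he hBe h𝓑d hQDB (hQZ Z hZ) h𝓒 (h𝓒 hB)).2 hB⟩
      simp only [hF, h1]
      rw [if_pos (subset_union_left.trans subset_union_left)]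
    have hcard : ∀ 𝓒 ⊆ 𝓑, ∀ Z ⊆ D, #(Q ∪ Z ∪ 𝓒.biUnion id) = r + #Z + #𝓒 * e := by
      intro 𝓒 h𝓒 Z hZ
      rw [card_union_biUnion_blocks (B := id) hBe h𝓑d hQDB (hQZ Z hZ) h𝓒,
        Finset.card_union_of_disjoint (hQD.mono_right hZ), hQc]
    set 𝓑' := {B ∈ 𝓑 | Disjoint B J} with h𝓑'
    have hbad : #{B ∈ 𝓑 | ¬ Disjoint B J} ≤ m :=
      (card_le_card_of_forall_not_disjoint (h𝓑d.subset (Finset.coe_subset.2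
        (Finset.filter_subset _ _))) fun B hB => (Finset.mem_filter.1 hB).2).trans hJ
    have hsplit : #𝓑' + #{B ∈ 𝓑 | ¬ Disjoint B J} = #𝓑 :=
      Finset.card_filter_add_card_filter_not (s := 𝓑) (fun B => Disjoint B J)
    -- All these points have the same trace `Q ∩ J` on `J`, so a function of that trace could not
    -- distinguish `P(i)` from `P(i + 1)`.
    have hpick : ∀ j ≤ t, ∃ x : Slice n k, F x.ones = P.eval (j : ℝ) ∧ x.ones ∩ J = Q ∩ J := by
      intro j hj
      obtain ⟨𝓒, h𝓒, h𝓒c⟩ := Finset.exists_subset_card_eq (show j ≤ #𝓑' by omega)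
      have h𝓒𝓑 : 𝓒 ⊆ 𝓑 := h𝓒.trans (Finset.filter_subset _ _)
      have hje : j * e ≤ t * e := Nat.mul_le_mul_right _ hj
      obtain ⟨Z, hZ, hZc⟩ := Finset.exists_subset_card_eq (show k - r - j * e ≤ #(D \ J) by
        have := Finset.le_card_sdiff J D
        omega)
      have hZD : Z ⊆ D := hZ.trans sdiff_subset
      refine ⟨Slice.ofOnes (Q ∪ Z ∪ 𝓒.biUnion id) ?_, ?_, ?_⟩
      · rw [hcard 𝓒 h𝓒𝓑 Z hZD, hZc, h𝓒c]
        omega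
      · rw [Slice.ones_ofOnes, hFval 𝓒 h𝓒𝓑 Z hZD, h𝓒c]
      · rw [Slice.ones_ofOnes]
        ext x
        simp only [Finset.mem_inter, Finset.mem_union, Finset.mem_biUnion]
        constructor
        · rintro ⟨(h | h) | ⟨B, hB, hx⟩, hJ⟩
          · exact ⟨h, hJ⟩
          · exact absurd hJ (Finset.mem_sdiff.1 (hZ h)).2
          · exact absurd hJ (Finset.disjoint_left.1 (Finset.mem_filter.1 (h𝓒 hB)).2 hx)
        · exact fun h => ⟨Or.inl (Or.inl h.1), h.2⟩
    obtain ⟨x, hx, hxJ⟩ := hpick i hit.le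
    obtain ⟨y, hy, hyJ⟩ := hpick (i + 1) hit
    refine hi ?_
    rw [← hx, ← hy]
    refine hfJ x y fun j hj => Fin.ext ?_
    rw [x.val_eq, y.val_eq]
    have : j ∈ x.ones ↔ j ∈ y.ones := by
      have h1 : j ∈ x.ones ∩ J ↔ j ∈ y.ones ∩ J := by rw [hxJ, hyJ]
      simpa [hj] using h1
    simp [this]

theorem exists_eval_ne_eval_succ {P : Polynomial ℝ} {t : ℕ} (hPt : P.natDegree ≤ t)
    (hP : ∀ c : ℝ, P ≠ Polynomial.C c) :
    ∃ i < t, P.eval (i : ℝ) ≠ P.eval ((i + 1 : ℕ) : ℝ) := by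
  by_contra hcon
  push Not at hcon
  have hconst : ∀ i : ℕ, i ≤ t → P.eval (i : ℝ) = P.eval ((0 : ℕ) : ℝ) := by
    intro i
    induction i with
    | zero => exact fun _ => rfl
    | succ i ih => exact fun hi => (hcon i hi).symm.trans (ih (by omega))
  refine hP (P.eval ((0 : ℕ) : ℝ)) (Polynomial.eq_of_natDegree_lt_card_of_eval_eq' P _
    ((Finset.range (t + 1)).map Nat.castEmbedding) ?_ ?_)
  · intro x hx
    obtain ⟨i, hi, rfl⟩ := Finset.mem_map.1 hx
    rw [Polynomial.eval_C]
    exact hconst i (by have := Finset.mem_range.1 hi; omega)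
  · simpa using Nat.lt_succ_of_le hPt

theorem exists_polynomial_nonconstant {A : Finset ℝ} (hA : 2 ≤ A.card) {t : ℕ} (ht : 1 ≤ t) :
    ∃ P : Polynomial ℝ, P.natDegree ≤ t ∧ (∀ i : ℕ, i ≤ t → P.eval (i : ℝ) ∈ A) ∧
      ∀ c : ℝ, P ≠ Polynomial.C c := by
  have h := Nat.notMem_of_lt_sInf (lt_W hA ht)
  simp only [Set.mem_ofPred_eq, ForcesConstant] at h
  push Not at h
  exact h

theorem exists_not_isJunta {A : Finset ℝ} (hA : 2 ≤ A.card) {d : ℕ} (hd : 1 ≤ d) {k : ℕ}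
    (hk1 : 1 ≤ k) (hk : k < threshold A d) (m : ℕ) :
    ∃ n : ℕ, 2 * k ≤ n ∧ ∃ f : Slice n k → ℝ, IsValuedIn A f ∧ HasDegree d f ∧ ¬ IsJunta m f := by
  obtain ⟨s, hs1, hsd, hks⟩ : ∃ s, 1 ≤ s ∧ s ≤ d ∧ k < d + d / s * (W A s - s) := by
    by_cases hkd : k < d
    · exact ⟨1, le_rfl, hd, by omega⟩
    · have : k - d < (Finset.Icc 1 d).sup (fun s => d / s * (W A s - s)) := by
        unfold threshold at hk
        omega
      obtain ⟨s, hs, hlt⟩ := Finset.lt_sup_iff.1 this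
      rw [Finset.mem_Icc] at hs
      exact ⟨s, hs.1, hs.2, by omega⟩
  set e := d / s with he
  have he1 : 1 ≤ e := (Nat.le_div_iff_mul_le (by omega)).2 (by omega)
  have hesd : e * s ≤ d := Nat.div_mul_le_self d s
  have hsW := lt_W hA hs1
  -- At most `s` blocks fit, so a polynomial of degree `s` might be constant on the attainable
  -- counts. A nonconstant one of degree at most that number is used instead; the `min` covers `k <
  -- e`.
  by_cases hsmall : k / min e k ≤ s
  · have h1 : 1 ≤ min e k := le_min he1 hk1
    have ht : 1 ≤ k / min e k := (Nat.le_div_iff_mul_le (by omega)).2 (by simp)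
    obtain ⟨P, hPd, hPA, hPc⟩ := exists_polynomial_nonconstant hA ht
    refine exists_not_isJunta_of_polynomial (r := 0) h1 hPA (exists_eval_ne_eval_succ hPd hPc)
      ?_ ?_ ?_ m
    · calc 0 + P.natDegree * min e k ≤ s * e := by
            rw [zero_add]; exact Nat.mul_le_mul (hPd.trans hsmall) (min_le_left _ _)
        _ ≤ d := by rwa [mul_comm]
    · rw [zero_add]; exact Nat.div_mul_le_self _ _
    · rw [zero_add, mul_comm]; exact Nat.lt_mul_div_succ _ (by omega)
  have hek : e ≤ k := by
    by_contra hlt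
    rw [min_eq_right (by omega), Nat.div_self (by omega)] at hsmall
    omega
  rw [min_eq_left hek] at hsmall
  obtain ⟨P, hPd, hPA, hPc⟩ : ∃ P : Polynomial ℝ, P.natDegree ≤ s ∧
      (∀ i : ℕ, i ≤ W A s - 1 → P.eval (i : ℝ) ∈ A) ∧ ∀ c : ℝ, P ≠ Polynomial.C c := by
    have h := Nat.notMem_of_lt_sInf (show W A s - 1 < W A s by omega)
    simp only [Set.mem_ofPred_eq, ForcesConstant] at h
    push Not at h
    exact h
  have hPe : P.natDegree * e ≤ s * e := Nat.mul_le_mul_right _ hPd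
  have hse : s * e ≤ d := by rwa [mul_comm]
  by_cases hkW : k < W A s * e
  · have htW : k / e < W A s := (Nat.div_lt_iff_lt_mul (by omega)).2 hkW
    refine exists_not_isJunta_of_polynomial (r := 0) (t := k / e) he1
      (fun i hi => hPA i (by omega)) (exists_eval_ne_eval_succ (by omega) hPc) (by omega) ?_ ?_ m
    · rw [zero_add]; exact Nat.div_mul_le_self _ _
    · rw [zero_add, mul_comm]; exact Nat.lt_mul_div_succ _ (by omega)
  · have h1 : (W A s - 1 + 1) * e = W A s * e := by rw [Nat.sub_add_cancel (by omega)]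
    have h2 : (W A s - 1) * e + e = W A s * e := by rw [← h1, Nat.succ_mul]
    have h3 : e * (W A s - s) + s * e = W A s * e := by
      rw [mul_comm s e, ← Nat.mul_add, Nat.sub_add_cancel hsW.le, mul_comm]
    -- The smallest `r` that prevents `W A s` full blocks beside `Q`; `r + s * e ≤ d` is exactly the
    -- assumption `k < d + e * (W A s - s)`.
    refine exists_not_isJunta_of_polynomial (r := k + 1 - W A s * e) (t := W A s - 1) he1
      hPA (exists_eval_ne_eval_succ (by omega) hPc) ?_ ?_ ?_ m <;> omega

end SliceJunta

theorem theorem1p2 (A : Finset ℝ) (hA : 2 ≤ A.card) (d : ℕ) (hd : 1 ≤ d) :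
    (SliceJunta.IsArithmeticProgression A → SliceJunta.threshold A d = A.card * d) ∧
    (∃ M : ℕ, ∀ k : ℕ, SliceJunta.threshold A d ≤ k → ∀ n : ℕ, 2 * k ≤ n →
      ∀ f : SliceJunta.Slice n k → ℝ, SliceJunta.IsValuedIn A f → SliceJunta.HasDegree d f →
        SliceJunta.IsJunta M f) ∧
    (∀ k : ℕ, 1 ≤ k → k < SliceJunta.threshold A d → ∀ m : ℕ,
      ∃ n : ℕ, 2 * k ≤ n ∧ ∃ f : SliceJunta.Slice n k → ℝ,
        SliceJunta.IsValuedIn A f ∧ SliceJunta.HasDegree d f ∧ ¬ SliceJunta.IsJunta m f) := by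
  exact ⟨SliceJunta.threshold_of_isArithmeticProgression hA hd, SliceJunta.exists_isJunta_bound A d,
    fun _ hk1 hk m => SliceJunta.exists_not_isJunta hA hd hk1 hk m⟩
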